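/- A circle packing is a collection $\mathcal S$ of closed disks in $\mathbb R^2$ of positive radii with pairwise disjoint interiors; $G_{\mathcal S}$ is the graph with vertex set $\mathcal S$ in which two disks are adjacent when they are tangent. Retain (declare open) each disk of $\mathcal S$ independently with probability $p$, and let $G_{\mathcal S}^p$ be the random subgraph of $G_{\mathcal S}$ induced on the open disks. For disks $s,t$ put $d(s,t)=\min\{\|x-y\|_\infty : x\in s,\ y\in t\}$. Call $p\in(0,1]$ universal if for every circle packing $\mathcal S$ and every $s_0\in\mathcal S$: (a) with probability $1$ there is no sequence $s_0,s_1,s_2,\dots$ of open disks of $\mathcal S$ with $s_n$ tangent to $s_{n+1}$ for all $n\ge 0$ and $d(s_0,s_n)\to\infty$; and (b) if $D:=\sup_{s\in\mathcal S}\operatorname{diam}(s)<\infty$, then for every $r>0$ the probability that $s_0$ is connected in $G_{\mathcal S}^p$ to some $s\in\mathcal S$ with $d(s_0,s)\ge r$ is at most $e^{-r/D}$. Then a universal $p$ exists. Moreover, let $p$ be universal, and let $\mathcal S$ be a circle packing that is locally finite (each disk is tangent to only finitely many other disks of $\mathcal S$) and has at most countably many accumulation points, that is, points of $\mathbb R^2$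 each of whose neighborhoods intersects infinitely many disks of $\mathcal S$. Then the probability that $G_{\mathcal S}^p$ has an infinite connected component is zero. -/

import Mathlib

open MeasureTheory ProbabilityTheory

noncomputable section

namespace CirclePacking

/-- The Euclidean plane. -/
abbrev Plane : Type := EuclideanSpace ℝ (Fin 2)

/-- A closed disk of positive radius in the plane. -/
@[ext]
structure Disk where
  center : Plane
  radius : ℝ
  radius_pos : 0 < radius

/-- The disk as a set of points. -/
def Disk.carrier (s : Disk) : Set Plane := Metric.closedBall s.center s.radius

/-- The diameter of a disk. -/
def Disk.diam (s : Disk) : ℝ := Metric.diam s.carrier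

/-- Two disks are (externally) tangent. For disks with disjoint interiors this is the same as
being distinct and having a common point. -/
def Disk.Tangent (s t : Disk) : Prop := dist s.center t.center = s.radius + t.radius

/-- The distance of two disks in the plane, with respect to the `ℓ_∞` norm: the supremum norm of
`Fin 2 → ℝ` is applied to the coordinates. -/
def Disk.supDist (s t : Disk) : ℝ :=
  sInf {δ : ℝ | ∃ x ∈ s.carrier, ∃ y ∈ t.carrier, δ = ‖WithLp.ofLp x - WithLp.ofLp y‖}

/-- A circle packing: a set of closed disks whose interiors are pairwise disjoint. -/
def IsCirclePacking (S : Set Disk) : Prop :=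
  S.Pairwise fun s t => Disjoint (interior s.carrier) (interior t.carrier)

/-- The tangency graph of a collection of disks. -/
def tangencyGraph (S : Set Disk) : SimpleGraph S where
  Adj s t := (s : Disk).Tangent (t : Disk)
  symm := ⟨fun s t h => by
    unfold Disk.Tangent at h ⊢
    rw [dist_comm, h, add_comm]⟩
  loopless := ⟨fun s h => by
    have hs := (s : Disk).radius_pos
    unfold Disk.Tangent at h
    rw [dist_self] at h
    linarith⟩

/-- Each disk is tangent to only finitely many other disks of the collection. -/
def IsLocallyFinite (S : Set Disk) : Prop :=
  ∀ s : S, ((tangencyGraph S).neighborSet s).Finite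

/-- The accumulation points: the points of the plane each of whose neighborhoods is intersected by
infinitely many disks. -/
def accumulationPoints (S : Set Disk) : Set Plane :=
  {x | ∀ U ∈ nhds x, {s ∈ S | (s.carrier ∩ U).Nonempty}.Infinite}

/-- The law of the random set of open (retained) disks in site percolation with parameter `p`:
each disk is open with probability `p`, independently of the others. -/
def sitePercolation (S : Set Disk) (p : unitInterval) : Measure (Set S) :=
  setBernoulli (Set.univ : Set S) p

/-- The subgraph of the tangency graph induced on the set `ω` of open disks. -/
def openGraph (S : Set Disk) (ω : Set S) : SimpleGraph ω := (tangencyGraph S).induce ω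

/-- The disks `s` and `t` are joined by a finite path of open disks (so both of them are open). -/
def OpenConnected {S : Set Disk} (ω : Set S) (s t : S) : Prop :=
  ∃ (hs : s ∈ ω) (ht : t ∈ ω), (openGraph S ω).Reachable ⟨s, hs⟩ ⟨t, ht⟩

/-- The event that `s₀` is connected by open disks to some disk at distance at least `r` from it. -/
def connectedToDistance {S : Set Disk} (s₀ : S) (r : ℝ) : Set (Set S) :=
  {ω | ∃ s : S, r ≤ (s₀ : Disk).supDist (s : Disk) ∧ OpenConnected ω s₀ s}

/-- The event that `s₀` is connected by open disks to infinity in the plane. -/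
def connectedToInfinity {S : Set Disk} (s₀ : S) : Set (Set S) :=
  {ω | ∃ σ : ℕ → S, σ 0 = s₀ ∧ (∀ n, σ n ∈ ω) ∧
    (∀ n, (tangencyGraph S).Adj (σ n) (σ (n + 1))) ∧
    Filter.Tendsto (fun n => (s₀ : Disk).supDist (σ n : Disk)) Filter.atTop Filter.atTop}

/-- The event that the graph of open disks has an infinite connected component. -/
def hasInfiniteComponent (S : Set Disk) : Set (Set S) :=
  {ω | ∃ C : (openGraph S ω).ConnectedComponent, C.supp.Infinite}

/-- The defining property of the universal percolation parameter: `p` is positive and, for every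
circle packing and each of its disks, almost surely no open path leads from the disk to infinity;
moreover, if the diameters of the disks are bounded, with supremum `D`, then the disk is connected
to distance `r` with probability at most `exp (-r / D)`. -/
def IsUniversalParameter (p : unitInterval) : Prop :=
  0 < (p : ℝ) ∧
    ∀ S : Set Disk, IsCirclePacking S → ∀ s₀ : S,
      sitePercolation S p (connectedToInfinity s₀) = 0 ∧
      (BddAbove (Disk.diam '' S) → ∀ r : ℝ, 0 < r →
        sitePercolation S p (connectedToDistance s₀ r) ≤
          ENNReal.ofReal (Real.exp (-(r / sSup (Disk.diam '' S)))))

end CirclePacking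

end

/-! The heart is an exponential bound that is uniform in scale (`measure_conn_near_far_le`): if all
radii are at most `ρ`, open disks lead from the `ρ`-ball around `z` to distance `r` with probability
at most `C * exp (-(r / ρ))`. It is proved by induction over dyadic scales. A crossing that uses
only disks of radius at most `ρ / 2` has twice the decay rate. Any other crossing reaches a big disk
`b` through small disks and goes on from `b`; a BK-type inequality (`setBernoulli_conn_union_le`)
bounds its probability by a sum over `b` of products. The doubled rate before `b` outweighs the
distance lost after it, and the big disks are separated, so the sum is bounded by a constant
(`BoundsSeparatedSums`) times `p`, which is small.

For bounded diameters this gives (b). For arbitrary radii, an annulus of fixed modulus is crossed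
with probability at most one half: the few disks larger than its inner radius are probably all
closed, and the others obey the exponential bound. Annuli so far apart that no disk meets two of
them are independent, which gives (a).

For the last claim, an infinite component contains a ray, by local finiteness. A ray that does not
go to infinity in the plane has an accumulation point, and must converge to it: otherwise it would
cross a whole interval of concentric spheres infinitely often and produce uncountably many
accumulation points. Inversion at the limit `x` turns the disks missing `x` into another packing
with the same tangencies, and the ray into a path to infinity, which has probability zero by (a).
The events are indexed by the countably many disks and accumulation points, so their union is null.
-/

namespace CirclePacking

/-! ### Independence for Bernoulli random sets. -/

section Probability

open unitInterval Measure

variable {α β : Type*}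

theorem setBernoulli_univ_eq_map (p : unitInterval) :
    setBernoulli (Set.univ : Set α) p = (infinitePi fun _ : α =>
      (toNNReal p • dirac True + toNNReal (σ p) • dirac False : Measure Prop)).map
        (fun P : α → Prop => {i | P i}) := by
  rw [setBernoulli_eq_map]
  simp

theorem measurable_setOf_pred : Measurable (fun P : α → Prop => {i | P i}) :=
  MeasurableEquiv.setOfPred.measurable

theorem measurable_mem_pred : Measurable (fun (ω : Set α) (i : α) => i ∈ ω) :=
  MeasurableEquiv.setOfPred.symm.measurable

instance isProbabilityMeasure_bernoulli_prop (p : unitInterval) : IsProbabilityMeasure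
    (toNNReal p • dirac True + toNNReal (σ p) • dirac False : Measure Prop) := by
  constructor
  simp

theorem map_mem_setBernoulli (p : unitInterval) :
    (setBernoulli (Set.univ : Set α) p).map (fun ω i => i ∈ ω) = infinitePi fun _ : α =>
      (toNNReal p • dirac True + toNNReal (σ p) • dirac False : Measure Prop) := by
  rw [setBernoulli_univ_eq_map, Measure.map_map measurable_mem_pred measurable_setOf_pred]
  exact Measure.map_id

theorem map_mem_setBernoulli_eval (p : unitInterval) (i : α) :
    (setBernoulli (Set.univ : Set α) p).map (fun ω => i ∈ ω) =
      (toNNReal p • dirac True + toNNReal (σ p) • dirac False : Measure Prop) := by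
  have h := infinitePi_map_eval (fun _ : α =>
      (toNNReal p • dirac True + toNNReal (σ p) • dirac False : Measure Prop)) i
  rw [← map_mem_setBernoulli, Measure.map_map (by fun_prop) measurable_mem_pred] at h
  exact h

theorem measurable_mem_set (i : α) : Measurable (fun ω : Set α => i ∈ ω) :=
  (measurable_pi_apply i).comp measurable_mem_pred

/-- The membership of the individual points in a Bernoulli random set are independent. -/
theorem iIndepFun_mem_setBernoulli (p : unitInterval) :
    iIndepFun (fun (i : α) (ω : Set α) => i ∈ ω) (setBernoulli (Set.univ : Set α) p) := by
  rw [iIndepFun_iff_map_fun_eq_infinitePi_map]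
  · simp_rw [map_mem_setBernoulli_eval, map_mem_setBernoulli]
  · exact measurable_mem_set

theorem setBernoulli_mem (p : unitInterval) (i : α) :
    setBernoulli (Set.univ : Set α) p {ω | i ∈ ω} = (toNNReal p : ENNReal) := by
  have h := congrArg (fun m => m {True}) (map_mem_setBernoulli_eval p i)
  rw [Measure.map_apply (measurable_mem_set i)
    (MeasurableSet.singleton _)] at h
  simpa [Set.preimage] using h

theorem setBernoulli_notMem (p : unitInterval) (i : α) :
    setBernoulli (Set.univ : Set α) p {ω | i ∉ ω} = (toNNReal (σ p) : ENNReal) := by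
  have h := congrArg (fun m => m {False}) (map_mem_setBernoulli_eval p i)
  rw [Measure.map_apply (measurable_mem_set i)
    (MeasurableSet.singleton _)] at h
  simpa [Set.preimage] using h

/-- This transfers null events from percolation on an inverted packing back to the original one. -/
theorem map_preimage_setBernoulli (p : unitInterval) {f : β → α} (hf : Function.Injective f) :
    (setBernoulli (Set.univ : Set α) p).map (fun ω => f ⁻¹' ω) =
      setBernoulli (Set.univ : Set β) p := by
  have h := map_infinitePi_infinitePi_of_inj (P := fun _ : α =>
      (toNNReal p • dirac True + toNNReal (σ p) • dirac False : Measure Prop)) hf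
  rw [setBernoulli_univ_eq_map (α := β), ← h, ← map_mem_setBernoulli,
    Measure.map_map (by fun_prop) measurable_mem_pred, Measure.map_map measurable_setOf_pred
    (Measurable.comp (by fun_prop) measurable_mem_pred)]
  rfl

theorem measurable_preimage_set (f : β → α) : Measurable (fun ω : Set α => f ⁻¹' ω) := by
  have : (fun ω : Set α => f ⁻¹' ω) = (fun P : β → Prop => {i | P i}) ∘
    (fun (P : α → Prop) i => P (f i)) ∘ (fun (ω : Set α) (i : α) => i ∈ ω) := rfl
  rw [this]
  exact measurable_setOf_pred.comp (Measurable.comp (by fun_prop) measurable_mem_pred)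

/-- An event that only depends on the random set within a finite set is a preimage under the
corresponding finite family of coordinates. -/
theorem setOf_inter_eq_preimage (A : Finset α) (Φ : Set α → Prop) :
    {ω : Set α | Φ (ω ∩ A)} = (fun (ω : Set α) (i : A) => (i : α) ∈ ω) ⁻¹'
      {g : A → Prop | Φ {a | ∃ h : a ∈ A, g ⟨a, h⟩}} := by
  ext ω
  have : ω ∩ A = {a | ∃ _ : a ∈ A, a ∈ ω} := by
    ext a
    simp [and_comm]
  simp [this]

theorem measurableSet_inter_finset (A : Finset α) (Φ : Set α → Prop) :
    MeasurableSet {ω : Set α | Φ (ω ∩ A)} := by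
  rw [setOf_inter_eq_preimage]
  refine Measurable.comp (g := fun (P : α → Prop) (i : A) => P i) (by fun_prop) measurable_mem_pred
    (Set.toFinite _).measurableSet

/-- Events depending on disjoint finite sets of points are independent. -/
theorem setBernoulli_inter_of_disjoint (p : unitInterval) {A B : Finset α} (hAB : Disjoint A B)
    (Φ Ψ : Set α → Prop) :
    setBernoulli (Set.univ : Set α) p {ω | Φ (ω ∩ A) ∧ Ψ (ω ∩ B)} =
      setBernoulli (Set.univ : Set α) p {ω | Φ (ω ∩ A)} *
        setBernoulli (Set.univ : Set α) p {ω | Ψ (ω ∩ B)} := by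
  have h := (iIndepFun_mem_setBernoulli (α := α) p).indepFun_finset A B hAB
    measurable_mem_set
  have h2 := h.measure_inter_preimage_eq_mul
    {g : A → Prop | Φ {a | ∃ h : a ∈ A, g ⟨a, h⟩}} {g : B → Prop | Ψ {a | ∃ h : a ∈ B, g ⟨a, h⟩}}
    (Set.toFinite _).measurableSet (Set.toFinite _).measurableSet
  rw [← setOf_inter_eq_preimage, ← setOf_inter_eq_preimage] at h2
  exact h2

/-- Conditioning on the state of one point. -/
theorem setBernoulli_inter_insert [DecidableEq α] (p : unitInterval) {V : Finset α} {v : α}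
    (hv : v ∉ V) (Φ : Set α → Prop) :
    setBernoulli (Set.univ : Set α) p {ω | Φ (ω ∩ ↑(insert v V))} =
      toNNReal p * setBernoulli (Set.univ : Set α) p {ω | Φ (insert v (ω ∩ V))} +
        toNNReal (σ p) * setBernoulli (Set.univ : Set α) p {ω | Φ (ω ∩ V)} := by
  have hm : MeasurableSet {ω : Set α | v ∈ ω} := by
    simpa using measurableSet_inter_finset ({v} : Finset α) (fun U => v ∈ U)
  rw [← measure_inter_add_sdiff _ hm]
  have h1 := setBernoulli_inter_of_disjoint p (A := {v}) (B := V) (by simpa using hv)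
    (fun U => v ∈ U) (fun U => Φ (insert v U))
  have h2 := setBernoulli_inter_of_disjoint p (A := {v}) (B := V) (by simpa using hv)
    (fun U => v ∉ U) (fun U => Φ U)
  simp only [Finset.coe_singleton, Set.mem_inter_iff, Set.mem_singleton_iff, and_true] at h1 h2
  rw [setBernoulli_mem] at h1
  rw [setBernoulli_notMem] at h2
  rw [← h1, ← h2]
  congr 2
  · ext ω
    simp only [Set.mem_inter_iff, Set.mem_ofPred_eq, Finset.coe_insert]
    rw [and_comm]
    refine and_congr_right fun h => ?_
    rw [Set.inter_insert_of_mem h]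
  · ext ω
    simp only [Set.mem_sdiff, Set.mem_ofPred_eq, Finset.coe_insert]
    rw [and_comm]
    refine and_congr_right fun h => ?_
    rw [Set.inter_insert_of_notMem h]

end Probability

/-! ### Connections in a random set and a BK-type inequality. -/

section Connection

open unitInterval

variable {α : Type*}

/-- There is a path within `W` from a vertex of `X` to a vertex of `Y`. -/
def Conn (G : SimpleGraph α) (W X Y : Set α) : Prop :=
  ∃ x ∈ W, x ∈ X ∧ ∃ y ∈ Y, Relation.ReflTransGen (fun a b => G.Adj a b ∧ b ∈ W) x y

variable {G : SimpleGraph α} {W W' X X' Y Y' : Set α}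

theorem reflTransGen_within_mono (h : W ⊆ W') {x y : α}
    (hxy : Relation.ReflTransGen (fun a b => G.Adj a b ∧ b ∈ W) x y) :
    Relation.ReflTransGen (fun a b => G.Adj a b ∧ b ∈ W') x y :=
  Relation.ReflTransGen.mono (fun _ _ hab => ⟨hab.1, h hab.2⟩) _ _ hxy

theorem Conn.mono (h : Conn G W X Y) (hW : W ⊆ W') (hX : X ⊆ X') (hY : Y ⊆ Y') :
    Conn G W' X' Y' := by
  obtain ⟨x, hxW, hxX, y, hy, hxy⟩ := h
  exact ⟨x, hW hxW, hX hxX, y, hY hy, reflTransGen_within_mono hW hxy⟩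

/-- A path either avoids `v`, or has a part from `v` on that does not return to `v`. -/
theorem conn_or_of_subset_insert {v : α} (hW : W' ⊆ insert v W) {x y : α} (hx : x ∈ W')
    (hy : y ∈ Y) (hxy : Relation.ReflTransGen (fun a b => G.Adj a b ∧ b ∈ W') x y) :
    v ∈ Y ∨ Conn G W (G.neighborSet v) Y ∨
      (x ∈ W ∧ Relation.ReflTransGen (fun a b => G.Adj a b ∧ b ∈ W) x y) := by
  induction hxy using Relation.ReflTransGen.head_induction_on with
  | refl =>
    rcases hW hx with rfl | h
    · exact Or.inl hy
    · exact Or.inr (Or.inr ⟨h, .refl⟩)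
  | head hac hcy ih =>
    rename_i a c
    rcases ih hac.2 with h | h | h
    · exact Or.inl h
    · exact Or.inr (Or.inl h)
    · rcases hW hx with rfl | ha
      · exact Or.inr (Or.inl ⟨c, h.1, hac.1, y, hy, h.2⟩)
      · exact Or.inr (Or.inr ⟨ha, .head ⟨hac.1, h.1⟩ h.2⟩)

/-- One step of cluster exploration: an open vertex of the starting set may be deleted once its
neighbors are added to the starting set. -/
theorem conn_insert_iff {v : α} (hv : v ∈ X) :
    Conn G (insert v W) X Y ↔ v ∈ Y ∨ Conn G W (X ∪ G.neighborSet v) Y := by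
  constructor
  · rintro ⟨x, hxW, hxX, y, hy, hxy⟩
    rcases conn_or_of_subset_insert subset_rfl hxW hy hxy with h | h | h
    · exact Or.inl h
    · exact Or.inr (h.mono subset_rfl Set.subset_union_right subset_rfl)
    · exact Or.inr ⟨x, h.1, Or.inl hxX, y, hy, h.2⟩
  · rintro (h | ⟨x, hxW, hxX, y, hy, hxy⟩)
    · exact ⟨v, Set.mem_insert _ _, hv, v, h, .refl⟩
    · have h1 := reflTransGen_within_mono (Set.subset_insert v W) hxy
      rcases hxX with h | h
      · exact ⟨x, Or.inr hxW, h, y, hy, h1⟩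
      · exact ⟨v, Or.inl rfl, hv, y, hy, .head ⟨h, Or.inr hxW⟩ h1⟩

theorem Conn.exists_finset {V : ℕ → Finset α} (hV : Monotone V) (hVu : ∀ a, ∃ n, a ∈ V n)
    (h : Conn G W X Y) : ∃ n, Conn G (W ∩ V n) X Y := by
  obtain ⟨x, hxW, hxX, y, hy, hxy⟩ := h
  have key : ∃ n, x ∈ V n ∧
      Relation.ReflTransGen (fun a b => G.Adj a b ∧ b ∈ W ∩ V n) x y := by
    clear hy
    induction hxy with
    | refl =>
      obtain ⟨n, hn⟩ := hVu x
      exact ⟨n, hn, .refl⟩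
    | tail _ hbc ih =>
      obtain ⟨n, hn, h⟩ := ih
      obtain ⟨m, hm⟩ := hVu _
      refine ⟨max n m, hV (le_max_left _ _) hn, .tail (reflTransGen_within_mono ?_ h)
        ⟨hbc.1, hbc.2, hV (le_max_right _ _) hm⟩⟩
      exact Set.inter_subset_inter_right _ (by exact_mod_cast hV (le_max_left _ _))
  obtain ⟨n, hn, h⟩ := key
  exact ⟨n, x, ⟨hxW, hn⟩, hxX, y, hy, h⟩

/-- A connection uses finitely many vertices only. -/
theorem measure_conn_le_of_finset [Countable α] [MeasurableSpace (Set α)] (μ : Measure (Set α))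
    {c : ENNReal} (h : ∀ V : Finset α, μ {ω | Conn G (ω ∩ V) X Y} ≤ c) :
    μ {ω | Conn G ω X Y} ≤ c := by
  classical
  obtain ⟨V, hV, hVu⟩ : ∃ V : ℕ → Finset α, Monotone V ∧ ∀ a, ∃ n, a ∈ V n := by
    obtain ⟨f, hf⟩ := exists_injective_nat α
    refine ⟨fun n => (Finset.range n).preimage f hf.injOn, fun m n hmn a ha => ?_,
      fun a => ⟨f a + 1, by simp⟩⟩
    simp only [Finset.mem_preimage, Finset.mem_range] at ha ⊢
    omega
  have hsub : {ω | Conn G ω X Y} ⊆ ⋃ n, {ω | Conn G (ω ∩ V n) X Y} := fun ω hω => by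
    simpa using Conn.exists_finset hV hVu hω
  refine (measure_mono hsub).trans ?_
  rw [Monotone.measure_iUnion]
  · exact iSup_le fun n => h _
  · intro m n hmn ω hω
    exact Conn.mono hω (Set.inter_subset_inter_right _ (by exact_mod_cast hV hmn)) subset_rfl
      subset_rfl

/-- A path within `V ∪ B` either stays within `V`, or reaches an open vertex `b` of `B` through a
cluster of `V` and goes on from `b` outside of that cluster. -/
theorem setBernoulli_conn_union_le [DecidableEq α] (p : unitInterval) (B : Finset α)
    (t : α → ENNReal) (V : Finset α) (hVB : Disjoint V B)
    (ht : ∀ b ∈ B, setBernoulli (Set.univ : Set α) p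
      {ω | b ∈ Y ∨ Conn G (ω ∩ ↑(V ∪ B.erase b)) (G.neighborSet b) Y} ≤ t b) (X : Set α) :
    setBernoulli (Set.univ : Set α) p {ω | Conn G (ω ∩ ↑(V ∪ B)) X Y} ≤
      setBernoulli (Set.univ : Set α) p {ω | Conn G (ω ∩ V) X Y} +
        ∑ b ∈ B, setBernoulli (Set.univ : Set α) p
          {ω | b ∈ X ∨ Conn G (ω ∩ V) X (G.neighborSet b)} * (toNNReal p * t b) := by
  -- The cluster of `X` in `V` is explored vertex by vertex: a vertex of `V` in `X` is removed from
  -- `V`, and if it is open its neighbors join `X`. The bounds `t` survive, since shrinking `V` only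
  -- makes their events smaller.
  induction V using Finset.strongInduction generalizing X with
  | H V ih =>
  set μ := setBernoulli (Set.univ : Set α) p with hμ
  by_cases hX : ∃ v ∈ V, v ∈ X
  · obtain ⟨v, hvV, hvX⟩ := hX
    have hvB : v ∉ B := Finset.disjoint_left.1 hVB hvV
    obtain ⟨V, hvV', rfl⟩ : ∃ V', v ∉ V' ∧ V = insert v V' :=
      ⟨V.erase v, Finset.notMem_erase _ _, (Finset.insert_erase hvV).symm⟩
    have hsub : V ⊆ insert v V := Finset.subset_insert _ _
    have hIH := ih V (Finset.ssubset_insert hvV') (Finset.disjoint_of_subset_left hsub hVB)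
      (fun b hb => (measure_mono fun ω hω => hω.imp_right fun h => h.mono
        (Set.inter_subset_inter_right _ (by
          exact_mod_cast Finset.union_subset_union_left hsub)) subset_rfl subset_rfl).trans
        (ht b hb))
    have h1 : μ {ω | Conn G (insert v (ω ∩ ↑(V ∪ B))) X Y} ≤
        μ {ω | Conn G (insert v (ω ∩ V)) X Y} + ∑ b ∈ B,
          μ {ω | b ∈ X ∨ Conn G (insert v (ω ∩ V)) X (G.neighborSet b)} * (toNNReal p * t b) := by
      simp only [conn_insert_iff hvX]
      by_cases hvY : v ∈ Y
      · simp only [hvY, true_or]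
        exact (measure_mono (Set.subset_univ _)).trans le_self_add
      · simp only [hvY, false_or]
        refine (hIH _).trans ?_
        refine add_le_add_right (Finset.sum_le_sum fun b hb =>
          mul_le_mul_left (measure_mono ?_) _) _
        rintro ω ((h | h) | h)
        · exact Or.inl h
        · exact Or.inr (Or.inl (G.adj_symm h))
        · exact Or.inr (Or.inr h)
    have e : ((insert v V ∪ B : Finset α)) = insert v (V ∪ B) := Finset.insert_union _ _ _
    have hvVB : v ∉ V ∪ B := by simp [hvV', hvB]
    rw [e, setBernoulli_inter_insert p hvVB fun U => Conn G U X Y,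
      setBernoulli_inter_insert p hvV' fun U => Conn G U X Y]
    have e2 (b : α) := setBernoulli_inter_insert p hvV'
      fun U => b ∈ X ∨ Conn G U X (G.neighborSet b)
    rw [Finset.sum_congr rfl fun b _ => congrArg (· * (toNNReal p * t b)) (e2 b)]
    calc _ ≤ toNNReal p * (μ {ω | Conn G (insert v (ω ∩ V)) X Y} + ∑ b ∈ B,
          μ {ω | b ∈ X ∨ Conn G (insert v (ω ∩ V)) X (G.neighborSet b)} * (toNNReal p * t b)) +
          toNNReal (σ p) * (μ {ω | Conn G (ω ∩ V) X Y} + ∑ b ∈ B,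
          μ {ω | b ∈ X ∨ Conn G (ω ∩ V) X (G.neighborSet b)} * (toNNReal p * t b)) := by
          gcongr
          exact hIH X
      _ = _ := by
          simp only [mul_add, add_mul, Finset.sum_add_distrib, Finset.mul_sum, mul_assoc]
          abel
  · classical
    push Not at hX
    -- The exploration is over: a path must start at some `b ∈ B ∩ X`, and is cut at its last visit
    -- to `b`. The rest avoids `b`, hence is independent of the state of `b`.
    have hsub : {ω | Conn G (ω ∩ ↑(V ∪ B)) X Y} ⊆ ⋃ b ∈ B.filter (· ∈ X),
        {ω | b ∈ ω ∧ (b ∈ Y ∨ Conn G (ω ∩ ↑(V ∪ B.erase b)) (G.neighborSet b) Y)} := by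
      rintro ω ⟨b, hbW, hbX, y, hy, hxy⟩
      have hbB : b ∈ B := by
        have : b ∈ V ∪ B := hbW.2
        rcases Finset.mem_union.1 this with h | h
        · exact absurd hbX (hX b h)
        · exact h
      have hbV : b ∉ V := fun h => hX b h hbX
      simp only [Set.mem_iUnion]
      refine ⟨b, Finset.mem_filter.2 ⟨hbB, hbX⟩, hbW.1, ?_⟩
      have hins : ω ∩ ↑(V ∪ B) ⊆ insert b (ω ∩ ↑(V ∪ B.erase b)) := by
        rintro a ⟨ha, haVB⟩
        by_cases hab : a = b
        · exact Or.inl hab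
        · refine Or.inr ⟨ha, ?_⟩
          simp only [Finset.coe_union, Set.mem_union, Finset.mem_coe, Finset.mem_erase] at haVB ⊢
          tauto
      rcases conn_or_of_subset_insert hins hbW hy hxy with h | h | h
      · exact Or.inl h
      · exact Or.inr h
      · have := h.1.2
        simp [hbV] at this
    refine (measure_mono hsub).trans ((measure_biUnion_finset_le _ _).trans ?_)
    refine le_trans ?_ le_add_self
    refine le_trans ?_ (Finset.sum_le_sum_of_subset (Finset.filter_subset (· ∈ X) B))
    refine Finset.sum_le_sum fun b hb => ?_
    obtain ⟨hbB, hbX⟩ := Finset.mem_filter.1 hb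
    have hbV : b ∉ V := fun h => hX b h hbX
    have hind := setBernoulli_inter_of_disjoint p (A := {b}) (B := V ∪ B.erase b)
      (by simpa using hbV) (fun U => b ∈ U) (fun U => b ∈ Y ∨ Conn G U (G.neighborSet b) Y)
    simp only [Finset.coe_singleton, Set.mem_inter_iff, Set.mem_singleton_iff, and_true] at hind
    rw [hind, setBernoulli_mem]
    simp only [hbX, true_or, Set.ofPred_true, measure_univ, one_mul]
    gcongr
    exact ht b hbB

end Connection

/-! ### Separated points and elementary disk geometry. -/

section Geometry

theorem norm_ofLp_le (v : Plane) : ‖WithLp.ofLp v‖ ≤ ‖v‖ :=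
  (pi_norm_le_iff_of_nonneg (norm_nonneg v)).2 fun i => PiLp.norm_apply_le v i

theorem norm_ofLp_sub_le_dist (x y : Plane) : ‖WithLp.ofLp x - WithLp.ofLp y‖ ≤ dist x y := by
  rw [dist_eq_norm, ← WithLp.ofLp_sub]
  exact norm_ofLp_le _

theorem dist_lt_of_abs_sub_lt {x y : Plane} {ρ : ℝ} (h : ∀ i, |x i - y i| < ρ / 2) :
    dist x y < ρ := by
  have hρ : 0 < ρ := by linarith [abs_nonneg (x 0 - y 0), h 0]
  rw [EuclideanSpace.dist_eq, Real.sqrt_lt' hρ]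
  simp only [Fin.sum_univ_two, Real.dist_eq]
  nlinarith [h 0, h 1, abs_nonneg (x 0 - y 0), abs_nonneg (x 1 - y 1)]

theorem summable_exp_neg_abs : Summable fun i : ℤ => Real.exp (-(|(i : ℝ)| / 4)) := by
  have h : Summable fun n : ℕ => Real.exp (-((n : ℝ) / 4)) := by
    have := Real.summable_exp_nat_mul_iff (a := -(1 / 4 : ℝ)) |>.2 (by norm_num)
    refine this.congr fun n => ?_
    congr 1
    ring
  refine Summable.of_nat_of_neg ?_ ?_ <;> simpa using h

/-- The number `K` bounds the sums of `exp (-d / ρ)` over `ρ`-separated sets of points, where `d` is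
the `ℓ_∞` distance from a fixed point. -/
def BoundsSeparatedSums (K : ℝ) : Prop :=
  ∀ (ι : Type) (s : Finset ι) (x : ι → Plane) (z : Fin 2 → ℝ) (ρ : ℝ), 0 < ρ →
    (∀ i ∈ s, ∀ j ∈ s, i ≠ j → ρ ≤ dist (x i) (x j)) →
    ∑ i ∈ s, Real.exp (-(‖WithLp.ofLp (x i) - z‖ / ρ)) ≤ K

/-- Separated points have a uniformly bounded exponential sum. -/
theorem exists_boundsSeparatedSums : ∃ K : ℝ, 0 < K ∧ BoundsSeparatedSums K := by
  set g : ℤ × ℤ → ℝ := fun c => Real.exp (1 / 2) *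
    (Real.exp (-(|(c.1 : ℝ)| / 4)) * Real.exp (-(|(c.2 : ℝ)| / 4))) with hg
  have hgs : Summable g := (summable_exp_neg_abs.mul_of_nonneg summable_exp_neg_abs
    (fun _ => (Real.exp_pos _).le) (fun _ => (Real.exp_pos _).le)).mul_left _
  have hgpos : ∀ c, 0 < g c := fun c => by positivity
  refine ⟨∑' c, g c, hgs.tsum_pos (fun c => (hgpos c).le) 0 (hgpos 0), ?_⟩
  intro ι s x z ρ hρ hx
  classical
  -- The plane is cut into square cells of side `ρ / 2`. Their diameter is less than `ρ`, so each
  -- contains at most one of the points, and `g` bounds the weight of a point in terms of its cell.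
  set u : ι → Fin 2 → ℝ := fun i k => 2 * (x i k - z k) / ρ with hu
  set f : ι → ℤ × ℤ := fun i => (⌊u i 0⌋, ⌊u i 1⌋) with hf
  have hinj : Set.InjOn f s := by
    intro i hi j hj hij
    by_contra hne
    have hd := hx i hi j hj hne
    have hk : ∀ k, ⌊u i k⌋ = ⌊u j k⌋ := by
      intro k
      fin_cases k
      · exact congrArg Prod.fst hij
      · exact congrArg Prod.snd hij
    refine absurd (dist_lt_of_abs_sub_lt (ρ := ρ) fun k => ?_) (not_lt.2 hd)
    have h1 := Int.abs_sub_lt_one_of_floor_eq_floor (hk k)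
    have h2 : u i k - u j k = (x i k - x j k) / (ρ / 2) := by
      simp only [hu]
      field_simp
      ring
    rwa [h2, abs_div, abs_of_pos (half_pos hρ), div_lt_one (half_pos hρ)] at h1
  have hle : ∀ i ∈ s, Real.exp (-(‖WithLp.ofLp (x i) - z‖ / ρ)) ≤ g (f i) := by
    intro i _
    simp only [hg, hf, ← Real.exp_add]
    refine Real.exp_le_exp.2 ?_
    have hfl : ∀ k, |(⌊u i k⌋ : ℝ)| ≤ 2 * (‖WithLp.ofLp (x i) - z‖ / ρ) + 1 := by
      intro k
      have h1 : |u i k| ≤ 2 * (‖WithLp.ofLp (x i) - z‖ / ρ) := by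
        have := norm_le_pi_norm (WithLp.ofLp (x i) - z) k
        simp only [Real.norm_eq_abs, Pi.sub_apply] at this
        simp only [hu]
        rw [abs_div, abs_mul, abs_two, abs_of_pos hρ, mul_div_assoc]
        gcongr
      have h2 := Int.floor_le (u i k)
      have h3 := Int.lt_floor_add_one (u i k)
      rw [abs_le] at h1 ⊢
      constructor <;> linarith
    linarith [hfl 0, hfl 1]
  calc _ ≤ ∑ i ∈ s, g (f i) := Finset.sum_le_sum hle
    _ = ∑ c ∈ s.image f, g c := (Finset.sum_image hinj).symm
    _ ≤ _ := hgs.sum_le_tsum _ fun c _ => (hgpos c).le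

theorem IsCirclePacking.radius_add_le {S : Set Disk} (hS : IsCirclePacking S) {s t : Disk}
    (hs : s ∈ S) (ht : t ∈ S) (hst : s ≠ t) : s.radius + t.radius ≤ dist s.center t.center := by
  have h : Disjoint (interior (Metric.closedBall s.center s.radius))
    (interior (Metric.closedBall t.center t.radius)) := hS hs ht hst
  rw [interior_closedBall _ s.radius_pos.ne',
    interior_closedBall _ t.radius_pos.ne', disjoint_ball_ball_iff s.radius_pos t.radius_pos] at h
  exact h

theorem isCirclePacking_of_radius_add_le {S : Set Disk} (h : ∀ s ∈ S, ∀ t ∈ S, s ≠ t →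
    s.radius + t.radius ≤ dist s.center t.center) : IsCirclePacking S := by
  intro s hs t ht hst
  show Disjoint (interior (Metric.closedBall _ _)) (interior (Metric.closedBall _ _))
  rw [interior_closedBall _ s.radius_pos.ne',
    interior_closedBall _ t.radius_pos.ne', disjoint_ball_ball_iff s.radius_pos t.radius_pos]
  exact h s hs t ht hst

theorem IsCirclePacking.countable {S : Set Disk} (hS : IsCirclePacking S) : S.Countable := by
  refine Set.PairwiseDisjoint.countable_of_isOpen (s := fun s : Disk => interior s.carrier) hS
    (fun _ _ => isOpen_interior) fun s _ => ?_
  rw [Disk.carrier, interior_closedBall _ s.radius_pos.ne']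
  exact ⟨s.center, Metric.mem_ball_self s.radius_pos⟩

/-- Tangent disks have a common point. -/
theorem Disk.Tangent.exists_mem {s t : Disk} (h : s.Tangent t) :
    ∃ y, y ∈ s.carrier ∧ y ∈ t.carrier := by
  have hs := s.radius_pos
  have ht := t.radius_pos
  refine ⟨AffineMap.lineMap s.center t.center (s.radius / (s.radius + t.radius)), ?_, ?_⟩
  · rw [Disk.carrier, Metric.mem_closedBall, dist_lineMap_left, h, Real.norm_of_nonneg (by positivity)]
    field_simp
    rfl
  · rw [Disk.carrier, Metric.mem_closedBall, dist_lineMap_right, h]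
    have : 1 - s.radius / (s.radius + t.radius) = t.radius / (s.radius + t.radius) := by
      field_simp
      ring
    rw [this, Real.norm_of_nonneg (by positivity)]
    field_simp
    rfl

theorem IsCirclePacking.tangent_of_mem {S : Set Disk} (hS : IsCirclePacking S) {s t : Disk}
    (hs : s ∈ S) (ht : t ∈ S) (hst : s ≠ t) {x : Plane} (hxs : x ∈ s.carrier)
    (hxt : x ∈ t.carrier) : s.Tangent t := by
  refine le_antisymm ?_ (hS.radius_add_le hs ht hst)
  rw [Disk.carrier, Metric.mem_closedBall] at hxs hxt
  linarith [dist_triangle_left s.center t.center x]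

/-- A point of a disk lies in a smaller disk contained in it. -/
theorem Disk.exists_center_of_le {s : Disk} {y : Plane} (hy : y ∈ s.carrier) {ρ : ℝ} (hρ : 0 ≤ ρ)
    (h : ρ ≤ s.radius) : ∃ c, dist c s.center ≤ s.radius - ρ ∧ dist c y ≤ ρ := by
  have hs := s.radius_pos
  rw [Disk.carrier, Metric.mem_closedBall, dist_comm] at hy
  refine ⟨AffineMap.lineMap s.center y ((s.radius - ρ) / s.radius), ?_, ?_⟩
  · rw [dist_lineMap_left, Real.norm_of_nonneg (div_nonneg (by linarith) hs.le)]
    calc _ ≤ (s.radius - ρ) / s.radius * s.radius := by gcongr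
      _ = _ := by field_simp
  · rw [dist_lineMap_right]
    have : 1 - (s.radius - ρ) / s.radius = ρ / s.radius := by
      field_simp
      ring
    rw [this, Real.norm_of_nonneg (by positivity)]
    calc _ ≤ ρ / s.radius * s.radius := by gcongr
      _ = _ := by field_simp

end Geometry
-- Exponential decay by induction over scales.
section Crossing

open unitInterval

/-- The disks that meet the `ℓ_∞` ball of radius `ρ` around `z`. -/
def near (S : Set Disk) (z : Fin 2 → ℝ) (ρ : ℝ) : Set S :=
  {s | ∃ y ∈ (s : Disk).carrier, ‖WithLp.ofLp y - z‖ ≤ ρ}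

/-- The disks that have a point at `ℓ_∞` distance at least `r` from `z`. -/
def far (S : Set Disk) (z : Fin 2 → ℝ) (r : ℝ) : Set S :=
  {s | ∃ y ∈ (s : Disk).carrier, r ≤ ‖WithLp.ofLp y - z‖}

variable {S : Set Disk}

theorem far_subset_far (z z' : Fin 2 → ℝ) {r r' : ℝ} (h : r' + ‖z' - z‖ ≤ r) :
    far S z r ⊆ far S z' r' := by
  rintro s ⟨y, hy, hr⟩
  refine ⟨y, hy, ?_⟩
  have := norm_sub_le_norm_sub_add_norm_sub (WithLp.ofLp y) z' z
  linarith

theorem norm_sub_center_le {s : Disk} {y : Plane} (hy : y ∈ s.carrier) :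
    ‖WithLp.ofLp y - WithLp.ofLp s.center‖ ≤ s.radius :=
  (norm_ofLp_sub_le_dist _ _).trans hy

theorem neighborSet_subset_near (b : S) {ρ : ℝ} (hb : (b : Disk).radius ≤ ρ) :
    (tangencyGraph S).neighborSet b ⊆ near S (WithLp.ofLp (b : Disk).center) ρ := by
  intro t ht
  obtain ⟨y, hyb, hyt⟩ := Disk.Tangent.exists_mem (s := b) (t := t) ht
  exact ⟨y, hyt, (norm_sub_center_le hyb).trans hb⟩

theorem neighborSet_subset_far (b : S) (z : Fin 2 → ℝ) {ρ : ℝ} (hb : (b : Disk).radius ≤ ρ) :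
    (tangencyGraph S).neighborSet b ⊆ far S z (‖WithLp.ofLp (b : Disk).center - z‖ - ρ) := by
  intro t ht
  obtain ⟨y, hyb, hyt⟩ := Disk.Tangent.exists_mem (s := b) (t := t) ht
  refine ⟨y, hyt, ?_⟩
  have h1 := norm_sub_center_le hyb
  have h2 := norm_sub_le_norm_sub_add_norm_sub (WithLp.ofLp (b : Disk).center) (WithLp.ofLp y) z
  rw [norm_sub_rev (WithLp.ofLp (b : Disk).center) (WithLp.ofLp y)] at h2
  linarith

/-- The centers of four `ℓ_∞` balls of radius `ρ / 2` that cover the one of radius `ρ`. -/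
noncomputable def quarterCenter (z : Fin 2 → ℝ) (ρ : ℝ) (ε : Fin 2 → Bool) : Fin 2 → ℝ :=
  fun k => z k + if ε k then ρ / 2 else -(ρ / 2)

theorem norm_quarterCenter_sub_le (z : Fin 2 → ℝ) {ρ : ℝ} (hρ : 0 < ρ) (ε : Fin 2 → Bool) :
    ‖quarterCenter z ρ ε - z‖ ≤ ρ / 2 := by
  refine (pi_norm_le_iff_of_nonneg (half_pos hρ).le).2 fun k => ?_
  simp only [quarterCenter, Pi.sub_apply, add_sub_cancel_left, Real.norm_eq_abs]
  split_ifs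
  · rw [abs_of_pos (half_pos hρ)]
  · rw [abs_neg, abs_of_pos (half_pos hρ)]

theorem exists_mem_near_quarterCenter (z : Fin 2 → ℝ) {ρ : ℝ} (hρ : 0 < ρ) {s : S}
    (hs : s ∈ near S z ρ) : ∃ ε, s ∈ near S (quarterCenter z ρ ε) (ρ / 2) := by
  obtain ⟨y, hy, hyz⟩ := hs
  refine ⟨fun k => decide (0 ≤ y k - z k), y, hy, ?_⟩
  refine (pi_norm_le_iff_of_nonneg (half_pos hρ).le).2 fun k => ?_
  have h1 := (norm_le_pi_norm (WithLp.ofLp y - z) k).trans hyz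
  simp only [quarterCenter, Pi.sub_apply, Real.norm_eq_abs, decide_eq_true_eq] at h1 ⊢
  rw [abs_le] at h1 ⊢
  split_ifs <;> constructor <;> linarith

/-- A union bound over the four half-size balls gives the factor 4; moving the center by up to `ρ /
2` costs a factor `exp 1` at scale `ρ / 2`. The gain is the rate `2 / ρ`. -/
theorem measure_conn_near_le_of_half {μ : Measure (Set S)} {V : Finset S} {ρ : ℝ}
    (hρ : 0 < ρ) {C : ℝ} (h : ∀ z r, μ {ω | Conn (tangencyGraph S) (ω ∩ V) (near S z (ρ / 2))
      (far S z r)} ≤ ENNReal.ofReal (C * Real.exp (-(r / (ρ / 2))))) (z : Fin 2 → ℝ) (r : ℝ) :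
    μ {ω | Conn (tangencyGraph S) (ω ∩ V) (near S z ρ) (far S z r)} ≤
      ENNReal.ofReal (4 * (C * Real.exp (1 - 2 * (r / ρ)))) := by
  have hsub : {ω | Conn (tangencyGraph S) (ω ∩ V) (near S z ρ) (far S z r)} ⊆
      ⋃ ε ∈ (Finset.univ : Finset (Fin 2 → Bool)), {ω | Conn (tangencyGraph S) (ω ∩ V)
        (near S (quarterCenter z ρ ε) (ρ / 2)) (far S (quarterCenter z ρ ε) (r - ρ / 2))} := by
    rintro ω ⟨x, hxW, hxX, y, hy, hxy⟩
    obtain ⟨ε, hε⟩ := exists_mem_near_quarterCenter z hρ hxX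
    simp only [Finset.mem_univ, Set.iUnion_true, Set.mem_iUnion]
    refine ⟨ε, x, hxW, hε, y, far_subset_far _ _ ?_ hy, hxy⟩
    linarith [norm_quarterCenter_sub_le z hρ ε]
  refine (measure_mono hsub).trans ((measure_biUnion_finset_le _ _).trans ?_)
  refine (Finset.sum_le_card_nsmul _ _ _ fun ε _ => h _ _).trans (le_of_eq ?_)
  have e : -((r - ρ / 2) / (ρ / 2)) = 1 - 2 * (r / ρ) := by
    field_simp
    ring
  rw [e, ENNReal.ofReal_mul (p := 4) (by norm_num)]
  simp [-ENNReal.ofReal_mul]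

/-- The chance of crossing a distance decays exponentially on the scale of the radii. -/
theorem measure_conn_near_far_le {K : ℝ}
    (hK : BoundsSeparatedSums K)
    {p : unitInterval} {C : ℝ} (hC : C = 8 * Real.exp 1)
    (hp : (p : ℝ) * (8 * C * Real.exp 3 * K) ≤ 1) (hS : IsCirclePacking S) (n : ℕ) {ρ : ℝ}
    (hρ : 0 < ρ) (V : Finset S)
    (hV : ∀ s ∈ V, ρ / 2 ^ n < (s : Disk).radius ∧ (s : Disk).radius ≤ ρ)
    (z : Fin 2 → ℝ) (r : ℝ) :
    sitePercolation S p {ω | Conn (tangencyGraph S) (ω ∩ V) (near S z ρ) (far S z r)} ≤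
      ENNReal.ofReal (C * Real.exp (-(r / ρ))) := by
  have hCpos : 0 < C := by rw [hC]; positivity
  have hp0 : 0 ≤ (p : ℝ) := p.2.1
  induction n generalizing ρ V z r with
  | zero =>
    have : V = ∅ := Finset.eq_empty_of_forall_notMem fun s hs => by
      have := hV s hs
      rw [pow_zero, div_one] at this
      linarith
    subst this
    have : {ω | Conn (tangencyGraph S) (ω ∩ ↑(∅ : Finset S)) (near S z ρ) (far S z r)} = ∅ := by
      ext ω
      simp [Conn]
    rw [this, measure_empty]
    exact zero_le
  | succ n ih =>
    classical
    set μ := sitePercolation S p with hμ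
    have : IsProbabilityMeasure μ := by rw [hμ, sitePercolation]; infer_instance
    set Vs : Finset S := V.filter fun s : S => (s : Disk).radius ≤ ρ / 2 with hVs
    have hsmall := measure_conn_near_le_of_half (μ := μ) (V := Vs) hρ (C := C) fun z r => by
      refine ih (half_pos hρ) Vs (fun s hs => ?_) z r
      rw [hVs, Finset.mem_filter] at hs
      refine ⟨?_, hs.2⟩
      convert (hV s hs.1).1 using 1
      rw [pow_succ]
      field_simp
    -- The big disks are added by an inner induction, because the way onward from `b` is again a
    -- crossing event, now without `b`.
    have main : ∀ B : Finset S,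
        (∀ b ∈ B, ρ / 2 < (b : Disk).radius ∧ (b : Disk).radius ≤ ρ) → ∀ z r,
        μ {ω | Conn (tangencyGraph S) (ω ∩ ↑(Vs ∪ B)) (near S z ρ) (far S z r)} ≤
          ENNReal.ofReal (C * Real.exp (-(r / ρ))) := by
      intro B
      induction B using Finset.strongInduction with
      | H B ihB =>
      intro hB z r
      -- Otherwise `8 * exp 1 * exp (-(r / ρ)) < 1`, which lets the quadratic term from the small
      -- disks be absorbed into half of the bound.
      by_cases hr : 1 ≤ C * Real.exp (-(r / ρ))
      · exact prob_le_one.trans (ENNReal.one_le_ofReal.2 hr)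
      push Not at hr
      have hdisj : Disjoint Vs B := Finset.disjoint_left.2 fun b hb hbB => by
        rw [hVs, Finset.mem_filter] at hb
        linarith [hb.2, (hB b hbB).1]
      set u : S → ℝ := fun b => ‖WithLp.ofLp (b : Disk).center - z‖ / ρ with hu
      have hnorm : ∀ b : S, ‖WithLp.ofLp (b : Disk).center - z‖ = u b * ρ := fun b => by
        simp only [hu]
        field_simp
      -- Recentering at `b` leaves a distance of `r - u b * ρ` to cross.
      have ht : ∀ b ∈ B, μ {ω | b ∈ far S z r ∨ Conn (tangencyGraph S) (ω ∩ ↑(Vs ∪ B.erase b))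
          ((tangencyGraph S).neighborSet b) (far S z r)} ≤
          ENNReal.ofReal (C * Real.exp (u b - r / ρ)) := by
        intro b hb
        by_cases hbf : b ∈ far S z r
        · refine prob_le_one.trans (ENNReal.one_le_ofReal.2 ?_)
          obtain ⟨y, hy, hyr⟩ := hbf
          have h1 := norm_sub_le_norm_sub_add_norm_sub (WithLp.ofLp y)
            (WithLp.ofLp (b : Disk).center) z
          have h2 := norm_sub_center_le hy
          have h3 : r / ρ ≤ 1 + u b := by
            rw [div_le_iff₀ hρ, add_mul, ← hnorm]
            linarith [(hB b hb).2]
          calc (1 : ℝ) ≤ 8 * Real.exp 1 * Real.exp (-1) := by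
                rw [mul_assoc, ← Real.exp_add]
                norm_num
            _ ≤ C * Real.exp (u b - r / ρ) := by
                rw [hC]
                gcongr
                linarith
        · have h1 := ihB (B.erase b) (Finset.erase_ssubset hb)
            (fun c hc => hB c (Finset.mem_of_mem_erase hc)) (WithLp.ofLp (b : Disk).center)
            (r - u b * ρ)
          refine (measure_mono fun ω hω => ?_).trans (h1.trans (le_of_eq ?_))
          · refine (hω.resolve_left hbf).mono subset_rfl
              (neighborSet_subset_near b (hB b hb).2) (far_subset_far _ _ ?_)
            rw [hnorm]
            linarith
          · congr 3
            field_simp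
            ring
      have hx : ∀ b ∈ B, μ {ω | b ∈ near S z ρ ∨ Conn (tangencyGraph S) (ω ∩ Vs) (near S z ρ)
          ((tangencyGraph S).neighborSet b)} ≤
          ENNReal.ofReal (4 * (C * Real.exp (3 - 2 * u b))) := by
        intro b hb
        by_cases hbn : b ∈ near S z ρ
        · refine prob_le_one.trans (ENNReal.one_le_ofReal.2 ?_)
          obtain ⟨y, hy, hyr⟩ := hbn
          have h1 := norm_sub_le_norm_sub_add_norm_sub (WithLp.ofLp (b : Disk).center)
            (WithLp.ofLp y) z
          rw [norm_sub_rev (WithLp.ofLp (b : Disk).center) (WithLp.ofLp y)] at h1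
          have h2 := norm_sub_center_le hy
          have h3 : u b ≤ 2 := by
            simp only [hu]
            rw [div_le_iff₀ hρ]
            linarith [(hB b hb).2]
          calc (1 : ℝ) ≤ 4 * (8 * Real.exp 1 * Real.exp (-1)) := by
                rw [mul_assoc 8, ← Real.exp_add]
                norm_num
            _ ≤ _ := by
                rw [hC]
                gcongr
                linarith
        · refine (measure_mono fun ω hω => ?_).trans
            ((hsmall z (u b * ρ - ρ)).trans (le_of_eq ?_))
          · refine (hω.resolve_left hbn).mono subset_rfl subset_rfl ?_
            rw [← hnorm]
            exact neighborSet_subset_far b z (hB b hb).2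
          · congr 4
            field_simp
            ring
      have hsum : ∑ b ∈ B, Real.exp (-u b) ≤ K := by
        refine hK S B (fun b => (b : Disk).center) z ρ hρ fun b hb c hc hbc => ?_
        have := hS.radius_add_le b.2 c.2 (fun h => hbc (Subtype.ext h))
        linarith [(hB b hb).1, (hB c hc).1]
      refine (setBernoulli_conn_union_le p B _ Vs hdisj ht _).trans ?_
      have hpe : ((toNNReal p : NNReal) : ENNReal) = ENNReal.ofReal p :=
        (ENNReal.ofReal_eq_coe_nnreal p.2.1).symm
      set a := Real.exp (-(r / ρ)) with ha
      have hapos : 0 < a := Real.exp_pos _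
      calc _ ≤ ENNReal.ofReal (4 * (C * Real.exp (1 - 2 * (r / ρ)))) +
            ∑ b ∈ B, ENNReal.ofReal (4 * (C * Real.exp (3 - 2 * u b))) *
              (ENNReal.ofReal p * ENNReal.ofReal (C * Real.exp (u b - r / ρ))) := by
            rw [hpe]
            gcongr with b hb
            · exact hsmall z r
            · exact hx b hb
        _ = ENNReal.ofReal (4 * (C * Real.exp (1 - 2 * (r / ρ))) +
            ∑ b ∈ B, 4 * (C * Real.exp (3 - 2 * u b)) * (p * (C * Real.exp (u b - r / ρ)))) := by
            rw [ENNReal.ofReal_add (by positivity)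
              (Finset.sum_nonneg fun b _ => by positivity),
              ENNReal.ofReal_sum_of_nonneg fun b _ => by positivity]
            congr 1
            refine Finset.sum_congr rfl fun b _ => ?_
            rw [← ENNReal.ofReal_mul hp0, ← ENNReal.ofReal_mul (by positivity)]
        _ ≤ _ := by
            refine ENNReal.ofReal_le_ofReal ?_
            have e1 : Real.exp (1 - 2 * (r / ρ)) = Real.exp 1 * (a * a) := by
              rw [ha, ← Real.exp_add, ← Real.exp_add]
              congr 1
              ring
            -- Decay `exp (-2 * u b)` on the way to `b` against the loss `exp (u b)` after it leaves
            -- the summable weight `exp (-u b)`.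
            have e2 : ∀ b : S, 4 * (C * Real.exp (3 - 2 * u b)) *
                (p * (C * Real.exp (u b - r / ρ))) =
                4 * C * C * p * Real.exp 3 * a * Real.exp (-u b) := by
              intro b
              have : Real.exp (3 - 2 * u b) * Real.exp (u b - r / ρ) =
                  Real.exp 3 * a * Real.exp (-u b) := by
                rw [ha, ← Real.exp_add, ← Real.exp_add, ← Real.exp_add]
                congr 1
                ring
              linear_combination 4 * C * C * p * this
            simp_rw [e1, e2]
            rw [← Finset.mul_sum]
            have h1 : 4 * (C * (Real.exp 1 * (a * a))) ≤ C * a / 2 := by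
              have : 8 * Real.exp 1 * a ≤ 1 := by rw [← hC]; exact hr.le
              nlinarith [mul_pos hCpos hapos]
            have h2 : 4 * C * C * p * Real.exp 3 * a * ∑ b ∈ B, Real.exp (-u b) ≤ C * a / 2 := by
              calc _ ≤ 4 * C * C * p * Real.exp 3 * a * K := by gcongr
                _ = C * a / 2 * (p * (8 * C * Real.exp 3 * K)) := by ring
                _ ≤ C * a / 2 * 1 := by gcongr
                _ = _ := mul_one _
            linarith
    have hVu : V = Vs ∪ V.filter fun s : S => ¬ (s : Disk).radius ≤ ρ / 2 :=
      (Finset.filter_union_filter_not_eq _ _).symm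
    rw [hVu]
    refine main _ (fun b hb => ?_) z r
    rw [Finset.mem_filter, not_le] at hb
    exact ⟨hb.2, (hV b hb.1).2⟩

end Crossing
-- Independent annuli and the existence of a universal parameter.
section Existence

variable {S : Set Disk}

instance isProbabilityMeasure_sitePercolation (p : unitInterval) :
    IsProbabilityMeasure (sitePercolation S p) := by
  rw [sitePercolation]
  infer_instance

theorem sitePercolation_mem (p : unitInterval) (s : S) :
    sitePercolation S p {ω | s ∈ ω} = ENNReal.ofReal p :=
  (setBernoulli_mem p s).trans (ENNReal.ofReal_eq_coe_nnreal p.2.1).symm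

/-- The preceding bound does not depend on the number `n` of scales, and a finite family has a
positive smallest radius. -/
theorem measure_conn_near_far_le_of_radius_le {K : ℝ}
    (hK : BoundsSeparatedSums K)
    {p : unitInterval} {C : ℝ} (hC : C = 8 * Real.exp 1)
    (hp : (p : ℝ) * (8 * C * Real.exp 3 * K) ≤ 1) (hS : IsCirclePacking S) {ρ : ℝ}
    (hρ : 0 < ρ) (V : Finset S) (hV : ∀ s ∈ V, (s : Disk).radius ≤ ρ)
    (z : Fin 2 → ℝ) (r : ℝ) :
    sitePercolation S p {ω | Conn (tangencyGraph S) (ω ∩ V) (near S z ρ) (far S z r)} ≤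
      ENNReal.ofReal (C * Real.exp (-(r / ρ))) := by
  have hn : ∀ V' : Finset S, ∃ n : ℕ, ∀ s ∈ V', ρ / 2 ^ n < (s : Disk).radius := by
    intro V'
    classical
    induction V' using Finset.induction with
    | empty => exact ⟨0, by simp⟩
    | insert a V' _ ih =>
      obtain ⟨n, hn⟩ := ih
      obtain ⟨m, hm⟩ := exists_nat_gt (ρ / (a : Disk).radius)
      have ha := (a : Disk).radius_pos
      have hm' : ρ / 2 ^ m < (a : Disk).radius := by
        rw [div_lt_iff₀ ha] at hm
        rw [div_lt_iff₀ (by positivity)]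
        have : (m : ℝ) < 2 ^ m := by exact_mod_cast Nat.lt_two_pow_self
        nlinarith
      refine ⟨max n m, fun s hs => ?_⟩
      have key : ∀ k ≤ max n m, ρ / 2 ^ max n m ≤ ρ / 2 ^ k := fun k hk => by
        gcongr
        norm_num
      rcases Finset.mem_insert.1 hs with rfl | hs
      · exact (key m (le_max_right _ _)).trans_lt hm'
      · exact (key n (le_max_left _ _)).trans_lt (hn s hs)
  obtain ⟨n, hn⟩ := hn V
  exact measure_conn_near_far_le hK hC hp hS n hρ V (fun s hs => ⟨hn s hs, hV s hs⟩) z r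

/-- Each disk contains a disk of radius `ρ` that is still close to `z`. The centers of these are
separated, and each contributes at least `exp (-(L + 1))` to a sum bounded by `K`. -/
theorem card_near_le {K : ℝ}
    (hK : BoundsSeparatedSums K)
    (hS : IsCirclePacking S) {ρ : ℝ} (hρ : 0 < ρ) (z : Fin 2 → ℝ) (L : ℝ) (V : Finset S)
    (hV : ∀ s ∈ V, ρ ≤ (s : Disk).radius ∧ s ∈ near S z (L * ρ)) :
    (V.card : ℝ) ≤ K * Real.exp (L + 1) := by
  have hx : ∀ s : S, ∃ x : Plane, s ∈ V →
      dist x (s : Disk).center ≤ (s : Disk).radius - ρ ∧ ‖WithLp.ofLp x - z‖ ≤ (L + 1) * ρ := by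
    intro s
    by_cases hs : s ∈ V
    · obtain ⟨h1, y, hy, hyz⟩ := hV s hs
      obtain ⟨x, hx1, hx2⟩ := Disk.exists_center_of_le hy hρ.le h1
      refine ⟨x, fun _ => ⟨hx1, ?_⟩⟩
      have := norm_sub_le_norm_sub_add_norm_sub (WithLp.ofLp x) (WithLp.ofLp y) z
      have := norm_ofLp_sub_le_dist x y
      linarith
    · exact ⟨0, fun h => absurd h hs⟩
  choose x hx using hx
  have h := hK S V x z ρ hρ fun s hs t ht hst => by
    have h1 := hS.radius_add_le s.2 t.2 (fun h => hst (Subtype.ext h))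
    have h2 := dist_triangle4 (s : Disk).center (x s) (x t) (t : Disk).center
    rw [dist_comm (s : Disk).center (x s)] at h2
    linarith [(hx s hs).1, (hx t ht).1]
  have h2 : V.card • Real.exp (-(L + 1)) ≤ K := by
    refine (Finset.card_nsmul_le_sum V _ _ fun s hs => ?_).trans h
    refine Real.exp_le_exp.2 (neg_le_neg ?_)
    rw [div_le_iff₀ hρ]
    exact (hx s hs).2
  rw [nsmul_eq_mul, Real.exp_neg] at h2
  have := Real.exp_pos (L + 1)
  calc (V.card : ℝ) = V.card * (Real.exp (L + 1))⁻¹ * Real.exp (L + 1) := by field_simp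
    _ ≤ _ := by gcongr

theorem mem_near_of_adj_of_notMem_far {z : Fin 2 → ℝ} {r : ℝ} {s t : S}
    (hst : (tangencyGraph S).Adj s t) (hs : s ∉ far S z r) : t ∈ near S z r := by
  obtain ⟨y, hys, hyt⟩ := Disk.Tangent.exists_mem (s := s) (t := t) hst
  refine ⟨y, hyt, ?_⟩
  by_contra h
  exact hs ⟨y, hys, (not_le.1 h).le⟩

theorem mem_far_of_adj_of_notMem_near {z : Fin 2 → ℝ} {r : ℝ} {s t : S}
    (hst : (tangencyGraph S).Adj s t) (ht : t ∉ near S z r) : s ∈ far S z r := by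
  obtain ⟨y, hys, hyt⟩ := Disk.Tangent.exists_mem (s := s) (t := t) hst
  refine ⟨y, hys, ?_⟩
  by_contra h
  exact ht ⟨y, hyt, (not_le.1 h).le⟩

/-- A path to distance `r` can be stopped when it first gets there. -/
theorem Conn.inter_near {z : Fin 2 → ℝ} {r : ℝ} {W X : Set S}
    (h : Conn (tangencyGraph S) W X (far S z r)) (hX : X ⊆ near S z r) :
    Conn (tangencyGraph S) (W ∩ near S z r) X (far S z r) := by
  obtain ⟨x, hxW, hxX, y, hy, hxy⟩ := h
  have key : Conn (tangencyGraph S) (W ∩ near S z r) X (far S z r) ∨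
      (y ∉ far S z r ∧ Relation.ReflTransGen
        (fun a b => (tangencyGraph S).Adj a b ∧ b ∈ W ∩ near S z r) x y) := by
    clear hy
    induction hxy with
    | refl =>
      by_cases hf : x ∈ far S z r
      · exact Or.inl ⟨x, ⟨hxW, hX hxX⟩, hxX, x, hf, .refl⟩
      · exact Or.inr ⟨hf, .refl⟩
    | tail _ hbc ih =>
      rename_i b c _
      rcases ih with ih | ih
      · exact Or.inl ih
      · have h1 := ih.2.tail ⟨hbc.1, hbc.2, mem_near_of_adj_of_notMem_far hbc.1 ih.1⟩
        by_cases hf : c ∈ far S z r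
        · exact Or.inl ⟨x, ⟨hxW, hX hxX⟩, hxX, c, hf, h1⟩
        · exact Or.inr ⟨hf, h1⟩
  exact key.resolve_right fun h => h.1 hy

/-- A path that starts close to `z` and gets to distance `r` can be started when it last leaves a
smaller ball. -/
theorem Conn.inter_far {z : Fin 2 → ℝ} {ρ r : ℝ} (hr : ρ ≤ r) {W X : Set S}
    (h : Conn (tangencyGraph S) W X (far S z r)) (hX : X ⊆ near S z ρ) :
    Conn (tangencyGraph S) (W ∩ far S z ρ) (near S z ρ) (far S z r) := by
  obtain ⟨x, hxW, hxX, y, hy, hxy⟩ := h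
  have hsub : far S z r ⊆ far S z ρ := far_subset_far z z (by simpa using hr)
  have key : Conn (tangencyGraph S) (W ∩ far S z ρ) (near S z ρ) (far S z r) ∨
      (x ∉ near S z ρ ∧ x ∈ W ∩ far S z ρ ∧ Relation.ReflTransGen
        (fun a b => (tangencyGraph S).Adj a b ∧ b ∈ W ∩ far S z ρ) x y) := by
    clear hxX
    induction hxy using Relation.ReflTransGen.head_induction_on with
    | refl =>
      by_cases hn : y ∈ near S z ρ
      · exact Or.inl ⟨y, ⟨hxW, hsub hy⟩, hn, y, hy, .refl⟩
      · exact Or.inr ⟨hn, ⟨hxW, hsub hy⟩, .refl⟩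
    | head hac _ ih =>
      rename_i a c _
      rcases ih hac.2 with ih | ih
      · exact Or.inl ih
      · have h1 := ih.2.2.head ⟨hac.1, ih.2.1⟩
        have h2 := mem_far_of_adj_of_notMem_near hac.1 ih.1
        by_cases hn : a ∈ near S z ρ
        · exact Or.inl ⟨a, ⟨hxW, h2⟩, hn, y, hy, h1⟩
        · exact Or.inr ⟨hn, ⟨hxW, h2⟩, h1⟩
  exact key.resolve_right fun h => h.1 (hX hxX)

/-- The disks close to a point are uniformly bounded. -/
theorem exists_notMem_far_of_mem_near {K : ℝ}
    (hK : BoundsSeparatedSums K)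
    (hS : IsCirclePacking S) (z : Fin 2 → ℝ) (R : ℝ) :
    ∃ ρ : ℝ, 0 < ρ ∧ ∀ s ∈ near S z R, s ∉ far S z ρ := by
  have hfin : {s : S | 1 ≤ (s : Disk).radius ∧ s ∈ near S z R}.Finite := by
    by_contra hinf
    obtain ⟨n, hn⟩ := exists_nat_gt (K * Real.exp (R + 1))
    obtain ⟨V, hV, hVc⟩ := Set.Infinite.exists_subset_card_eq hinf n
    have := card_near_le hK hS one_pos z R V fun s hs => by simpa using hV hs
    rw [hVc] at this
    linarith
  -- The finitely many disks of radius at least 1 reach at most distance `M`; a smaller one reaches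
  -- less than `R + 2`.
  obtain ⟨M, hM⟩ := (hfin.image fun s : S =>
    ‖WithLp.ofLp (s : Disk).center - z‖ + (s : Disk).radius).bddAbove
  refine ⟨max (M + 1) (max (R + 3) 1), by positivity, ?_⟩
  rintro s hs ⟨y, hy, hyr⟩
  have hyc := norm_sub_center_le hy
  have h1 := norm_sub_le_norm_sub_add_norm_sub (WithLp.ofLp y) (WithLp.ofLp (s : Disk).center) z
  by_cases hr : 1 ≤ (s : Disk).radius
  · have h2 := hM ⟨s, ⟨hr, hs⟩, rfl⟩
    have := le_max_left (M + 1) (max (R + 3) 1)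
    simp only at h2
    linarith
  · obtain ⟨w, hw, hwR⟩ := hs
    have hwc := norm_sub_center_le hw
    have h2 := norm_sub_le_norm_sub_add_norm_sub (WithLp.ofLp (s : Disk).center) (WithLp.ofLp w) z
    rw [norm_sub_rev (WithLp.ofLp (s : Disk).center) (WithLp.ofLp w)] at h2
    have := (le_max_left (R + 3) 1).trans (le_max_right (M + 1) (max (R + 3) 1))
    linarith

/-- The chance of crossing an annulus of a fixed modulus is at most one half. -/
theorem measure_crossing_le_half {K : ℝ}
    (hK : BoundsSeparatedSums K) (hKpos : 0 < K)
    {p : unitInterval} {C : ℝ} (hC : C = 8 * Real.exp 1)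
    (hp : (p : ℝ) * (8 * C * Real.exp 3 * K) ≤ 1) (hS : IsCirclePacking S) {ρ : ℝ}
    (hρ : 0 < ρ) (z : Fin 2 → ℝ) (V : Finset S)
    (hV : ∀ s ∈ V, s ∈ near S z (Real.log (4 * C) * ρ)) :
    sitePercolation S p {ω | Conn (tangencyGraph S) (ω ∩ V) (near S z ρ)
      (far S z (Real.log (4 * C) * ρ))} ≤ 2⁻¹ := by
  classical
  have hCpos : 0 < C := by rw [hC]; positivity
  have hp0 : 0 ≤ (p : ℝ) := p.2.1
  set L := Real.log (4 * C) with hL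
  have hLe : Real.exp L = 4 * C := Real.exp_log (by positivity)
  set Vs : Finset S := V.filter fun s : S => (s : Disk).radius ≤ ρ with hVs
  set B : Finset S := V.filter fun s : S => ¬ (s : Disk).radius ≤ ρ with hB
  have hsub : {ω | Conn (tangencyGraph S) (ω ∩ V) (near S z ρ) (far S z (L * ρ))} ⊆
      {ω | Conn (tangencyGraph S) (ω ∩ Vs) (near S z ρ) (far S z (L * ρ))} ∪
        ⋃ b ∈ B, {ω | b ∈ ω} := by
    intro ω hω
    by_cases h : ∃ b ∈ B, b ∈ ω
    · right
      simpa using h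
    · left
      refine Conn.mono hω ?_ subset_rfl subset_rfl
      rintro s ⟨hsω, hsV⟩
      refine ⟨hsω, ?_⟩
      by_contra hs
      refine h ⟨s, ?_, hsω⟩
      rw [hB, Finset.mem_filter]
      rw [hVs, Finset.mem_coe, Finset.mem_filter] at hs
      exact ⟨hsV, fun h => hs ⟨hsV, h⟩⟩
  -- One quarter of the probability goes to some big disk being open, with `hcard` bounding their
  -- number, and one quarter to a crossing by small disks; `L` satisfies `C * exp (-L) = 1 / 4`.
  have hcard := card_near_le hK hS hρ z L B fun s hs => by
    rw [hB, Finset.mem_filter, not_le] at hs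
    exact ⟨hs.2.le, hV s hs.1⟩
  have hsmall := measure_conn_near_far_le_of_radius_le hK hC hp hS hρ Vs
    (fun s hs => (Finset.mem_filter.1 hs).2) z (L * ρ)
  have e1 : C * Real.exp (-(L * ρ / ρ)) = 1 / 4 := by
    rw [mul_div_cancel_right₀ _ hρ.ne', Real.exp_neg, hLe]
    field_simp
  rw [e1] at hsmall
  have hbig : sitePercolation S p (⋃ b ∈ B, {ω | b ∈ ω}) ≤ ENNReal.ofReal (1 / 4) := by
    refine (measure_biUnion_finset_le _ _).trans ?_
    simp only [sitePercolation_mem, Finset.sum_const, nsmul_eq_mul]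
    rw [← ENNReal.ofReal_natCast, ← ENNReal.ofReal_mul (Nat.cast_nonneg _)]
    refine ENNReal.ofReal_le_ofReal ?_
    have e3 : 2 * Real.exp 1 ≤ Real.exp 3 := by
      rw [show (3 : ℝ) = 2 + 1 by norm_num, Real.exp_add]
      gcongr
      linarith [Real.add_one_le_exp (2 : ℝ)]
    rw [Real.exp_add, hLe] at hcard
    have h4 : (p : ℝ) * (K * (4 * C * Real.exp 1)) ≤ 1 / 4 := by
      have : (p : ℝ) * (8 * C * (2 * Real.exp 1) * K) ≤ 1 := le_trans (by gcongr) hp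
      linarith
    calc _ ≤ K * (4 * C * Real.exp 1) * p := by gcongr
      _ ≤ _ := by linarith
  calc _ ≤ _ := measure_mono hsub
    _ ≤ _ := measure_union_le _ _
    _ ≤ ENNReal.ofReal (1 / 4) + ENNReal.ofReal (1 / 4) := add_le_add hsmall hbig
    _ = 2⁻¹ := by
      rw [← ENNReal.ofReal_add (by norm_num) (by norm_num), ← ENNReal.ofReal_ofNat,
        ← ENNReal.ofReal_inv_of_pos (by norm_num)]
      norm_num

/-- Each further annulus contributes an independent factor one half. `R` is uniform in the finite
set `V`, so the bound passes to the whole packing. -/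
theorem exists_measure_conn_far_le {K : ℝ}
    (hK : BoundsSeparatedSums K) (hKpos : 0 < K)
    {p : unitInterval} {C : ℝ} (hC : C = 8 * Real.exp 1)
    (hp : (p : ℝ) * (8 * C * Real.exp 3 * K) ≤ 1) (hS : IsCirclePacking S) {z : Fin 2 → ℝ}
    {X : Set S} (hX : X ⊆ near S z 0) (m : ℕ) :
    ∃ R : ℝ, 0 ≤ R ∧ ∀ V : Finset S, sitePercolation S p
      {ω | Conn (tangencyGraph S) (ω ∩ V) X (far S z R)} ≤ 2⁻¹ ^ m := by
  classical
  have hnear : ∀ {a b : ℝ}, a ≤ b → near S z a ⊆ near S z b := fun hab s ⟨y, hy, h⟩ =>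
    ⟨y, hy, h.trans hab⟩
  have hL : 1 ≤ Real.log (4 * C) := by
    rw [Real.le_log_iff_exp_le (by rw [hC]; positivity), hC]
    linarith [Real.exp_pos 1]
  induction m with
  | zero => exact ⟨0, le_rfl, fun V => by simpa using prob_le_one⟩
  | succ m ih =>
    obtain ⟨R, hR, h⟩ := ih
    -- The next annulus starts where no disk meeting the `R`-ball can reach, which makes `V₁` and
    -- `V₂` disjoint.
    obtain ⟨ρ, hρ, hfar⟩ := exists_notMem_far_of_mem_near hK hS z R
    set L := Real.log (4 * C)
    refine ⟨max (L * ρ) R, by positivity, fun V => ?_⟩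
    set V₁ : Finset S := V.filter fun s => s ∈ near S z R with hV₁
    set V₂ : Finset S := V.filter fun s => s ∈ near S z (L * ρ) ∧ s ∈ far S z ρ with hV₂
    have hdisj : Disjoint V₁ V₂ := Finset.disjoint_left.2 fun s h1 h2 =>
      hfar s (Finset.mem_filter.1 h1).2 (Finset.mem_filter.1 h2).2.2
    have hind := setBernoulli_inter_of_disjoint p hdisj
      (fun U => Conn (tangencyGraph S) U X (far S z R))
      (fun U => Conn (tangencyGraph S) U (near S z ρ) (far S z (L * ρ)))
    have hsub : {ω | Conn (tangencyGraph S) (ω ∩ V) X (far S z (max (L * ρ) R))} ⊆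
        {ω | Conn (tangencyGraph S) (ω ∩ V₁) X (far S z R) ∧
          Conn (tangencyGraph S) (ω ∩ V₂) (near S z ρ) (far S z (L * ρ))} := by
      intro ω hω
      constructor
      · have h1 : Conn (tangencyGraph S) (ω ∩ V) X (far S z R) :=
          Conn.mono hω subset_rfl subset_rfl (far_subset_far z z (by simp))
        refine (h1.inter_near (hX.trans (hnear hR))).mono ?_ subset_rfl subset_rfl
        rintro s ⟨⟨h1, h2⟩, h3⟩
        exact ⟨h1, Finset.mem_coe.2 (Finset.mem_filter.2 ⟨h2, h3⟩)⟩
      · have h1 : Conn (tangencyGraph S) (ω ∩ V) X (far S z (L * ρ)) :=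
          Conn.mono hω subset_rfl subset_rfl (far_subset_far z z (by simp))
        have h2 := (h1.inter_near (hX.trans (hnear (by positivity)))).inter_far
          (ρ := ρ) (by nlinarith) (hX.trans (hnear hρ.le))
        refine h2.mono ?_ subset_rfl subset_rfl
        rintro s ⟨⟨⟨h1, h2⟩, h3⟩, h4⟩
        exact ⟨h1, Finset.mem_coe.2 (Finset.mem_filter.2 ⟨h2, h3, h4⟩)⟩
    calc _ ≤ _ := measure_mono hsub
      _ = _ := hind
      _ ≤ 2⁻¹ ^ m * 2⁻¹ := by
        refine mul_le_mul' (h V₁) (measure_crossing_le_half hK hKpos hC hp hS hρ z V₂ ?_)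
        exact fun s hs => (Finset.mem_filter.1 hs).2.1
      _ = _ := (pow_succ _ _).symm

theorem Disk.supDist_le {s t : Disk} {x y : Plane} (hx : x ∈ s.carrier) (hy : y ∈ t.carrier) :
    s.supDist t ≤ ‖WithLp.ofLp y - WithLp.ofLp x‖ := by
  refine csInf_le ⟨0, ?_⟩ ⟨x, hx, y, hy, norm_sub_rev _ _⟩
  rintro δ ⟨_, _, _, _, rfl⟩
  exact norm_nonneg _

theorem Disk.center_mem (s : Disk) : s.center ∈ s.carrier :=
  Metric.mem_closedBall_self s.radius_pos.le

theorem mem_far_of_le_supDist {s t : S} {r : ℝ} (h : r ≤ (s : Disk).supDist t) :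
    t ∈ far S (WithLp.ofLp (s : Disk).center) r :=
  ⟨(t : Disk).center, Disk.center_mem _,
    h.trans (Disk.supDist_le (Disk.center_mem _) (Disk.center_mem _))⟩

theorem mem_near_center (s : S) {ρ : ℝ} (hρ : 0 ≤ ρ) :
    s ∈ near S (WithLp.ofLp (s : Disk).center) ρ :=
  ⟨(s : Disk).center, Disk.center_mem _, by simpa using hρ⟩

theorem OpenConnected.conn {ω : Set S} {s t : S} (h : OpenConnected ω s t) {Y : Set S}
    (ht : t ∈ Y) : Conn (tangencyGraph S) ω {s} Y := by
  obtain ⟨hs, htω, h⟩ := h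
  rw [SimpleGraph.reachable_iff_reflTransGen] at h
  refine ⟨s, hs, rfl, t, ht, ?_⟩
  exact Relation.ReflTransGen.lift (fun x : ω => (x : S)) (fun a b hab => ⟨hab, b.2⟩) _ _ h

theorem conn_of_path {ω : Set S} {σ : ℕ → S} (hσ : ∀ n, σ n ∈ ω)
    (hadj : ∀ n, (tangencyGraph S).Adj (σ n) (σ (n + 1))) {Y : Set S} {n : ℕ} (hn : σ n ∈ Y) :
    Conn (tangencyGraph S) ω {σ 0} Y := by
  refine ⟨σ 0, hσ 0, rfl, σ n, hn, ?_⟩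
  clear hn
  induction n with
  | zero => exact .refl
  | succ n ih => exact ih.tail ⟨hadj n, hσ _⟩

theorem Disk.diam_eq (s : Disk) : s.diam = 2 * s.radius := by
  rw [Disk.diam, Disk.carrier, Metric.diam_closedBall_eq _ s.radius_pos.le]

theorem exists_isUniversalParameter : ∃ p : unitInterval, IsUniversalParameter p := by
  obtain ⟨K, hKpos, hK⟩ := exists_boundsSeparatedSums
  obtain ⟨C, hC⟩ : ∃ C, C = 8 * Real.exp 1 := ⟨_, rfl⟩
  have hCpos : 0 < C := by rw [hC]; positivity
  set M := 8 * C * Real.exp 3 * K with hM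
  have hMpos : 0 < M := by positivity
  -- Both `p * M ≤ 1`, for the induction over scales, and `p * C ≤ 1`, for small `r` in (b), are
  -- needed.
  set p : unitInterval := ⟨(1 + M + C)⁻¹, by positivity, inv_le_one_of_one_le₀ (by linarith)⟩
  have hpv : (p : ℝ) = (1 + M + C)⁻¹ := rfl
  have hp : (p : ℝ) * M ≤ 1 := by
    rw [hpv, inv_mul_le_one₀ (by positivity)]
    linarith
  have hpC : (p : ℝ) * C ≤ 1 := by
    rw [hpv, inv_mul_le_one₀ (by positivity)]
    linarith
  refine ⟨p, by rw [hpv]; positivity, fun S hS s₀ => ?_⟩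
  have : Countable S := hS.countable.to_subtype
  refine ⟨?_, fun hbdd r hr => ?_⟩
  · have hX : ({s₀} : Set S) ⊆ near S (WithLp.ofLp (s₀ : Disk).center) 0 :=
      Set.singleton_subset_iff.2 (mem_near_center s₀ le_rfl)
    have hle : ∀ m : ℕ, sitePercolation S p (connectedToInfinity s₀) ≤ 2⁻¹ ^ m := by
      intro m
      obtain ⟨R, _, h⟩ := exists_measure_conn_far_le hK hKpos hC hp hS hX m
      refine (measure_mono ?_).trans (measure_conn_le_of_finset _ h)
      rintro ω ⟨σ, rfl, hσ, hadj, hlim⟩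
      obtain ⟨n, hn⟩ := (hlim.eventually_ge_atTop R).exists
      exact conn_of_path hσ hadj (mem_far_of_le_supDist hn)
    have hlim : Filter.Tendsto (fun m : ℕ => (2⁻¹ : ENNReal) ^ m) Filter.atTop (nhds 0) :=
      ENNReal.tendsto_pow_atTop_nhds_zero_of_lt_one (by norm_num)
    exact le_antisymm (ge_of_tendsto' hlim hle) zero_le
  · set D := sSup (Disk.diam '' S) with hD
    have hrad : ∀ s : S, (s : Disk).radius ≤ D / 2 := fun s => by
      have := le_csSup hbdd ⟨s, s.2, rfl⟩
      rw [Disk.diam_eq] at this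
      linarith
    have hDpos : 0 < D / 2 := (s₀ : Disk).radius_pos.trans_le (hrad s₀)
    -- Radii are at most `D / 2`, so the crossing bound is `C * exp (-(2 * r / D))`. Half of the
    -- exponent pays for `C` when `r` is large; for small `r` it suffices that `s₀` itself is open
    -- with probability at most `1 / C`.
    by_cases hx : 1 ≤ C * Real.exp (-(r / D))
    · refine (measure_mono (t := {ω | s₀ ∈ ω}) ?_).trans ?_
      · rintro ω ⟨s, _, hs, _⟩
        exact hs
      · rw [sitePercolation_mem]
        refine ENNReal.ofReal_le_ofReal ?_
        by_contra hlt
        push Not at hlt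
        nlinarith
    · refine (measure_mono ?_).trans ((measure_conn_le_of_finset _ fun V =>
        measure_conn_near_far_le_of_radius_le hK hC hp hS hDpos V (fun s _ => hrad s)
          (WithLp.ofLp (s₀ : Disk).center) r).trans (ENNReal.ofReal_le_ofReal ?_))
      · rintro ω ⟨s, hs, hconn⟩
        exact (hconn.conn (mem_far_of_le_supDist hs)).mono subset_rfl
          (Set.singleton_subset_iff.2 (mem_near_center s₀ hDpos.le)) subset_rfl
      · have e : -(r / (D / 2)) = -(r / D) + -(r / D) := by
          field_simp
          ring
        rw [e, Real.exp_add]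
        nlinarith [Real.exp_pos (-(r / D))]

end Existence
-- Rays of disks and their accumulation points.
section Ray

/-- An infinite component of a locally finite graph contains a ray. -/
theorem exists_ray_of_infinite_component {α : Type*} {G : SimpleGraph α}
    (hG : ∀ v, (G.neighborSet v).Finite) {C : G.ConnectedComponent} (hC : C.supp.Infinite) :
    ∃ σ : ℕ → α, Function.Injective σ ∧ ∀ n, G.Adj (σ n) (σ (n + 1)) := by
  obtain ⟨v₀, hv₀⟩ := hC.nonempty
  -- `D v` consists of the vertices `w` for which some geodesic from `v₀` to `w` passes through `v`.
  -- As in König's lemma, an infinite `D v` has a neighbor of `v`, one step farther from `v₀`, with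
  -- infinite `D`; growing distances make the ray injective.
  set D : α → Set α := fun v =>
    {w | G.Reachable v w ∧ G.dist v₀ w = G.dist v₀ v + G.dist v w} with hD
  have hD₀ : (D v₀).Infinite := hC.mono fun w hw => by
    refine ⟨?_, by simp⟩
    rw [SimpleGraph.ConnectedComponent.mem_supp_iff] at hv₀ hw
    exact SimpleGraph.ConnectedComponent.exact (hv₀.trans hw.symm)
  have step : ∀ v : {v // G.Reachable v₀ v ∧ (D v).Infinite},
      ∃ u : {v // G.Reachable v₀ v ∧ (D v).Infinite},
        G.Adj v u ∧ G.dist v₀ u = G.dist v₀ v + 1 := by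
    rintro ⟨v, hv, hDv⟩
    by_contra hno
    push Not at hno
    have hN : {u ∈ G.neighborSet v | G.dist v₀ u = G.dist v₀ v + 1}.Finite :=
      (hG v).subset (Set.sep_subset _ _)
    refine hDv (((hN.biUnion (t := D) fun u hu => ?_).insert v).subset ?_)
    · by_contra hinf
      exact hno ⟨u, hv.trans hu.1.reachable, hinf⟩ hu.1 hu.2
    · rintro w ⟨hvw, hw⟩
      obtain ⟨q, hq⟩ := hvw.exists_walk_length_eq_dist
      cases q with
      | nil => exact Or.inl rfl
      | cons hvu q =>
        rename_i u
        right
        rw [SimpleGraph.Walk.length_cons] at hq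
        have h1 : G.dist u w ≤ q.length := SimpleGraph.dist_le q
        have h2 : G.dist v₀ u ≤ G.dist v₀ v + 1 := by
          obtain ⟨q', hq'⟩ := hv.exists_walk_length_eq_dist
          have := SimpleGraph.dist_le (q'.concat hvu)
          rwa [SimpleGraph.Walk.length_concat, hq'] at this
        have h3 : G.dist v₀ w ≤ G.dist v₀ u + G.dist u w := by
          obtain ⟨q₁, hq₁⟩ := (hv.trans hvu.reachable).exists_walk_length_eq_dist
          obtain ⟨q₂, hq₂⟩ := q.reachable.exists_walk_length_eq_dist
          have := SimpleGraph.dist_le (q₁.append q₂)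
          rwa [SimpleGraph.Walk.length_append, hq₁, hq₂] at this
        refine Set.mem_biUnion (x := u) ⟨hvu, ?_⟩ ⟨q.reachable, ?_⟩ <;> omega
  choose next hadj hdist using step
  set σ : ℕ → {v // G.Reachable v₀ v ∧ (D v).Infinite} :=
    fun n => Nat.rec ⟨v₀, SimpleGraph.Reachable.refl _, hD₀⟩ (fun _ v => next v) n with hσ
  have hσs : ∀ n, σ (n + 1) = next (σ n) := fun n => rfl
  have hσd : ∀ n, G.dist v₀ (σ n) = n := by
    intro n
    induction n with
    | zero => exact SimpleGraph.dist_self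
    | succ n ih => rw [hσs, hdist, ih]
  refine ⟨fun n => σ n, fun m n hmn => ?_, fun n => ?_⟩
  · rw [← hσd m, ← hσd n]
    exact congrArg _ hmn
  · simp only [hσs]
    exact hadj _

variable {S : Set Disk}

theorem Disk.isPreconnected_carrier (s : Disk) : IsPreconnected s.carrier :=
  (convex_closedBall _ _).isPreconnected

theorem exists_frequently_of_isCompact {τ : ℕ → Disk} {K : Set Plane} (hK : IsCompact K)
    (h : ∃ᶠ n in Filter.atTop, ((τ n).carrier ∩ K).Nonempty) :
    ∃ x ∈ K, ∀ U ∈ nhds x, ∃ᶠ n in Filter.atTop, ((τ n).carrier ∩ U).Nonempty := by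
  have hy : ∀ n, ∃ y ∈ (τ n).carrier, ((τ n).carrier ∩ K).Nonempty → y ∈ K := by
    intro n
    by_cases hn : ((τ n).carrier ∩ K).Nonempty
    · obtain ⟨y, hy, hyK⟩ := hn
      exact ⟨y, hy, fun _ => hyK⟩
    · exact ⟨_, (τ n).center_mem, fun h => absurd h hn⟩
  choose y hyτ hyK using hy
  obtain ⟨x, hx, hxy⟩ := hK.exists_mapClusterPt_of_frequently (h.mono hyK)
  exact ⟨x, hx, fun U hU => (hxy.frequently hU).mono fun n hn => ⟨y n, hyτ n, hn⟩⟩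

theorem mem_accumulationPoints_of_frequently {τ : ℕ → S} (hτ : Function.Injective τ) {x : Plane}
    (h : ∀ U ∈ nhds x, ∃ᶠ n in Filter.atTop, ((τ n : Disk).carrier ∩ U).Nonempty) :
    x ∈ accumulationPoints S := by
  intro U hU
  have h1 : {n | ((τ n : Disk).carrier ∩ U).Nonempty}.Infinite :=
    Nat.frequently_atTop_iff_infinite.1 (h U hU)
  refine (h1.image (f := fun n => (τ n : Disk))
    (Subtype.val_injective.comp hτ).injOn).mono ?_
  rintro _ ⟨n, hn, rfl⟩
  exact ⟨(τ n).2, hn⟩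

/-- A path of disks that keeps oscillating between a ball and the complement of a larger one meets
each intermediate sphere infinitely often. -/
theorem frequently_inter_sphere {τ : ℕ → S}
    (hadj : ∀ n, (tangencyGraph S).Adj (τ n) (τ (n + 1))) {x : Plane} {t : ℝ}
    (hin : ∃ᶠ n in Filter.atTop, ((τ n : Disk).carrier ∩ Metric.ball x t).Nonempty)
    (hout : ∃ᶠ n in Filter.atTop, ¬ (τ n : Disk).carrier ⊆ Metric.ball x t) :
    ∃ᶠ n in Filter.atTop, ((τ n : Disk).carrier ∩ Metric.sphere x t).Nonempty := by
  -- Disks are connected, so one that misses the sphere lies on one side of it, and tangent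
  -- neighbors that both miss it lie on the same side.
  have hdich : ∀ n, ¬ ((τ n : Disk).carrier ∩ Metric.sphere x t).Nonempty →
      ((τ n : Disk).carrier ∩ Metric.ball x t).Nonempty →
      (τ n : Disk).carrier ⊆ Metric.ball x t := by
    rintro n hn ⟨y, hy, hyt⟩ w hw
    by_contra hwt
    rw [Metric.mem_ball, not_lt] at hwt
    obtain ⟨v, hv, hvt⟩ := (τ n : Disk).isPreconnected_carrier.intermediate_value hy hw
      (f := fun v => dist v x) (by fun_prop) ⟨(Metric.mem_ball.1 hyt).le, hwt⟩
    exact hn ⟨v, hv, hvt⟩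
  rw [Filter.frequently_atTop] at hin hout ⊢
  intro N
  obtain ⟨n, hn, hnt⟩ := hin N
  obtain ⟨m, hm, hmt⟩ := hout n
  by_contra hno
  push Not at hno
  have hno' : ∀ k ≥ N, ¬ ((τ k : Disk).carrier ∩ Metric.sphere x t).Nonempty := fun k hk => by
    rw [hno k hk]
    exact Set.not_nonempty_empty
  have key : ∀ k, n ≤ k → (τ k : Disk).carrier ⊆ Metric.ball x t := by
    intro k hk
    induction k, hk using Nat.le_induction with
    | base => exact hdich n (hno' n hn) hnt
    | succ k hk ih =>
      obtain ⟨y, hy, hy'⟩ := Disk.Tangent.exists_mem (s := τ k) (t := τ (k + 1)) (hadj k)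
      exact hdich _ (hno' _ (by omega)) ⟨y, hy', ih hy⟩
  exact hmt (key m hm)

/-- A path of disks that has an accumulation point converges to it, if there are only countably many
accumulation points. -/
theorem eventually_subset_ball (hacc : (accumulationPoints S).Countable) {τ : ℕ → S}
    (hτ : Function.Injective τ) (hadj : ∀ n, (tangencyGraph S).Adj (τ n) (τ (n + 1))) {x : Plane}
    (hx : ∀ U ∈ nhds x, ∃ᶠ n in Filter.atTop, ((τ n : Disk).carrier ∩ U).Nonempty) {δ : ℝ}
    (hδ : 0 < δ) : ∀ᶠ n in Filter.atTop, (τ n : Disk).carrier ⊆ Metric.ball x δ := by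
  by_contra hcon
  rw [Filter.not_eventually] at hcon
  -- Without convergence, every radius in `(0, δ)` is the distance from `x` to an accumulation
  -- point, which is impossible for countably many of them.
  have hsub : Set.Ioo 0 δ ⊆ (fun y => dist y x) '' accumulationPoints S := by
    rintro t ⟨ht, htδ⟩
    have h1 := frequently_inter_sphere hadj (hx _ (Metric.ball_mem_nhds x ht))
      (hcon.mono fun n hn h => hn (h.trans (Metric.ball_subset_ball htδ.le)))
    obtain ⟨y, hy, hyf⟩ := exists_frequently_of_isCompact (τ := fun n => (τ n : Disk))
      (isCompact_sphere x t) h1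
    exact ⟨y, mem_accumulationPoints_of_frequently hτ hyf, hy⟩
  have := (hacc.image _).mono hsub
  rw [Cardinal.Real.Ioo_countable_iff] at this
  linarith

theorem norm_le_two_mul_norm_ofLp (v : Plane) : ‖v‖ ≤ 2 * ‖WithLp.ofLp v‖ := by
  have h0 := norm_le_pi_norm (WithLp.ofLp v) 0
  have h1 := norm_le_pi_norm (WithLp.ofLp v) 1
  rw [EuclideanSpace.norm_eq]
  refine Real.sqrt_le_iff.2 ⟨by positivity, ?_⟩
  simp only [Fin.sum_univ_two]
  nlinarith [norm_nonneg (WithLp.ofLp v 0), norm_nonneg (WithLp.ofLp v 1)]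

/-- A sequence of disks that leaves every ball goes to infinity. -/
theorem tendsto_supDist {τ : ℕ → Disk} (s : Disk)
    (h : ∀ M : ℝ, ∀ᶠ n in Filter.atTop, ∀ w ∈ (τ n).carrier, M ≤ ‖w‖) :
    Filter.Tendsto (fun n => s.supDist (τ n)) Filter.atTop Filter.atTop := by
  refine Filter.tendsto_atTop.2 fun M => ?_
  filter_upwards [h (2 * (M + (‖s.center‖ + s.radius)))] with n hn
  refine le_csInf ⟨_, s.center, s.center_mem, (τ n).center, (τ n).center_mem, rfl⟩ ?_
  rintro δ ⟨u, hu, w, hw, rfl⟩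
  have h1 := hn w hw
  have h2 := norm_le_two_mul_norm_ofLp w
  have h3 := norm_ofLp_le u
  have h4 : ‖u‖ ≤ ‖s.center‖ + s.radius := by
    have : dist u s.center ≤ s.radius := hu
    rw [dist_eq_norm] at this
    have := norm_le_norm_add_norm_sub' u s.center
    linarith
  have h5 := norm_sub_norm_le (WithLp.ofLp w) (WithLp.ofLp u)
  rw [norm_sub_rev] at h5
  linarith

end Ray

/-! ### Inversion of disks in a unit circle. -/

section Inversion

/-- The power of the point `x` with respect to the boundary of the disk. -/
noncomputable def Disk.power (x : Plane) (s : Disk) : ℝ := ‖s.center - x‖ ^ 2 - s.radius ^ 2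

theorem Disk.power_pos {x : Plane} {s : Disk} (h : x ∉ s.carrier) : 0 < s.power x := by
  rw [Disk.carrier, Metric.mem_closedBall, not_le, dist_comm, dist_eq_norm] at h
  have := s.radius_pos
  rw [Disk.power]
  nlinarith

open Classical in
/-- The image of a disk under the inversion in the unit circle around the point `x` outside of it,
followed by the translation that moves `x` to the origin. -/
noncomputable def Disk.invert (x : Plane) (s : Disk) : Disk :=
  if h : 0 < s.power x then
    ⟨(s.power x)⁻¹ • (s.center - x), (s.power x)⁻¹ * s.radius,
      mul_pos (inv_pos.2 h) s.radius_pos⟩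
  -- A default value; the inversion is only used for `x` outside the disk.
  else s

theorem Disk.invert_center {x : Plane} {s : Disk} (h : x ∉ s.carrier) :
    (s.invert x).center = (s.power x)⁻¹ • (s.center - x) := by
  rw [Disk.invert, dif_pos (Disk.power_pos h)]

theorem Disk.invert_radius {x : Plane} {s : Disk} (h : x ∉ s.carrier) :
    (s.invert x).radius = (s.power x)⁻¹ * s.radius := by
  rw [Disk.invert, dif_pos (Disk.power_pos h)]

/-- The quantity that vanishes at tangency and is nonnegative in a packing is only rescaled by a
positive factor. Both properties are thus preserved with no need to describe the image of a disk
pointwise. -/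
theorem Disk.dist_invert_sq {x : Plane} {s t : Disk} (hs : x ∉ s.carrier) (ht : x ∉ t.carrier) :
    dist (s.invert x).center (t.invert x).center ^ 2 -
        ((s.invert x).radius + (t.invert x).radius) ^ 2 =
      (s.power x)⁻¹ * (t.power x)⁻¹ *
        (dist s.center t.center ^ 2 - (s.radius + t.radius) ^ 2) := by
  have ha := Disk.power_pos hs
  have hb := Disk.power_pos ht
  rw [Disk.invert_center hs, Disk.invert_center ht, Disk.invert_radius hs, Disk.invert_radius ht,
    dist_eq_norm, dist_eq_norm, ← sub_sub_sub_cancel_right s.center t.center x, norm_sub_sq_real,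
    norm_sub_sq_real, norm_smul, norm_smul, inner_smul_left, inner_smul_right,
    Real.norm_of_nonneg (inv_pos.2 ha).le, Real.norm_of_nonneg (inv_pos.2 hb).le]
  have ea : ‖s.center - x‖ ^ 2 = s.power x + s.radius ^ 2 := by rw [Disk.power]; ring
  have eb : ‖t.center - x‖ ^ 2 = t.power x + t.radius ^ 2 := by rw [Disk.power]; ring
  rw [mul_pow, mul_pow, ea, eb]
  simp only [conj_trivial]
  field_simp
  ring

theorem Disk.tangent_invert_iff {x : Plane} {s t : Disk} (hs : x ∉ s.carrier)
    (ht : x ∉ t.carrier) : (s.invert x).Tangent (t.invert x) ↔ s.Tangent t := by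
  have h := Disk.dist_invert_sq hs ht
  have hab := mul_pos (inv_pos.2 (Disk.power_pos hs)) (inv_pos.2 (Disk.power_pos ht))
  have h1 := s.radius_pos
  have h2 := t.radius_pos
  have h3 := (s.invert x).radius_pos
  have h4 := (t.invert x).radius_pos
  rw [Disk.Tangent, Disk.Tangent, ← sq_eq_sq₀ dist_nonneg (by positivity),
    ← sq_eq_sq₀ dist_nonneg (by positivity), ← sub_eq_zero, h, ← sub_eq_zero (b := _ ^ 2),
    mul_eq_zero, or_iff_right hab.ne']

theorem Disk.radius_add_le_dist_invert {x : Plane} {s t : Disk} (hs : x ∉ s.carrier)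
    (ht : x ∉ t.carrier) (hst : s.radius + t.radius ≤ dist s.center t.center) :
    (s.invert x).radius + (t.invert x).radius ≤
      dist (s.invert x).center (t.invert x).center := by
  have h := Disk.dist_invert_sq hs ht
  have hab := mul_pos (inv_pos.2 (Disk.power_pos hs)) (inv_pos.2 (Disk.power_pos ht))
  have h1 := s.radius_pos
  have h2 := t.radius_pos
  refine (sq_le_sq₀ (add_nonneg (Disk.radius_pos _).le (Disk.radius_pos _).le) dist_nonneg).1 ?_
  have : 0 ≤ dist s.center t.center ^ 2 - (s.radius + t.radius) ^ 2 :=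
    sub_nonneg.2 (pow_le_pow_left₀ (by positivity) hst 2)
  have := mul_nonneg hab.le this
  linarith

/-- The inverses of disks close to `x` are far away from the origin. -/
theorem Disk.le_norm_of_mem_invert {x : Plane} {s : Disk} (hs : x ∉ s.carrier) {δ : ℝ}
    (hδ : 0 < δ) (hsub : s.carrier ⊆ Metric.ball x δ) {w : Plane}
    (hw : w ∈ (s.invert x).carrier) : (2 * δ)⁻¹ ≤ ‖w‖ := by
  have ha := Disk.power_pos hs
  have hr := s.radius_pos
  have hc : ‖s.center - x‖ < δ := by
    rw [← dist_eq_norm]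
    exact hsub s.center_mem
  have hrδ : s.radius ≤ δ := by
    have h1 := Metric.diam_mono hsub Metric.isBounded_ball
    have h2 := Metric.diam_ball (x := x) hδ.le
    rw [Disk.carrier, Metric.diam_closedBall_eq _ hr.le] at h1
    linarith
  rw [Disk.carrier, Metric.mem_closedBall, Disk.invert_center hs, Disk.invert_radius hs,
    dist_eq_norm] at hw
  have h1 := norm_le_norm_add_norm_sub w ((s.power x)⁻¹ • (s.center - x))
  rw [norm_smul, Real.norm_of_nonneg (inv_pos.2 ha).le] at h1
  -- The point of the inverted disk nearest to the origin corresponds to the point of the disk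
  -- farthest from `x`.
  have h2 : (s.power x)⁻¹ * (‖s.center - x‖ - s.radius) = (‖s.center - x‖ + s.radius)⁻¹ := by
    have h3 : s.power x = (‖s.center - x‖ - s.radius) * (‖s.center - x‖ + s.radius) := by
      rw [Disk.power]
      ring
    have h4 : 0 < ‖s.center - x‖ + s.radius := by positivity
    have h5 : ‖s.center - x‖ - s.radius ≠ 0 := by
      intro h
      rw [h3, h, zero_mul] at ha
      exact lt_irrefl _ ha
    rw [h3]
    field_simp
  have h6 : (2 * δ)⁻¹ ≤ (‖s.center - x‖ + s.radius)⁻¹ := by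
    gcongr
    linarith
  linarith

end Inversion
-- Absence of infinite components.
section NoInfiniteComponent

variable {S : Set Disk}

/-- The event that there is a path of open disks from `s` that avoids the point `x` and converges
to it. -/
def connectedToPoint (x : Plane) (s : S) : Set (Set S) :=
  {ω | ∃ τ : ℕ → S, τ 0 = s ∧ (∀ n, τ n ∈ ω) ∧
    (∀ n, (tangencyGraph S).Adj (τ n) (τ (n + 1))) ∧ (∀ n, x ∉ (τ n : Disk).carrier) ∧
    ∀ δ : ℝ, 0 < δ → ∀ᶠ n in Filter.atTop, (τ n : Disk).carrier ⊆ Metric.ball x δ}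

/-- Inversion at `x` turns convergence to `x` into escape to infinity in the packing `T`, where
universality applies; the two percolations are coupled through the injection `f`. -/
theorem IsUniversalParameter.connectedToPoint_eq_zero {p : unitInterval}
    (hp : IsUniversalParameter p) (hS : IsCirclePacking S) (x : Plane) (s : S) :
    sitePercolation S p (connectedToPoint x s) = 0 := by
  by_cases hxs : x ∈ (s : Disk).carrier
  · convert measure_empty (μ := sitePercolation S p)
    rw [Set.eq_empty_iff_forall_notMem]
    rintro ω ⟨τ, rfl, -, -, h, -⟩
    exact h 0 hxs
  set T : Set Disk := Disk.invert x '' {t ∈ S | x ∉ t.carrier} with hT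
  have hTS : IsCirclePacking T := by
    refine isCirclePacking_of_radius_add_le ?_
    rintro _ ⟨t, ht, rfl⟩ _ ⟨u, hu, rfl⟩ htu
    exact Disk.radius_add_le_dist_invert ht.2 hu.2
      (hS.radius_add_le ht.1 hu.1 fun h => htu (congrArg _ h))
  choose g hgS hg using fun t : T => t.2
  set f : T → S := fun t => ⟨g t, (hgS t).1⟩ with hf
  have hfinj : Function.Injective f := fun t u htu => by
    have : g t = g u := congrArg Subtype.val htu
    exact Subtype.ext ((hg t).symm.trans ((congrArg _ this).trans (hg u)))
  set i : ∀ t : S, x ∉ (t : Disk).carrier → T :=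
    fun t ht => ⟨Disk.invert x t, t, ⟨t.2, ht⟩, rfl⟩ with hi
  -- Inversion is injective on the packing: two different disks would keep disjoint interiors and
  -- cannot have the same image.
  have hfi : ∀ t ht, f (i t ht) = t := by
    intro t ht
    by_contra hne
    have h1 := hS.radius_add_le (f (i t ht)).2 t.2 fun h => hne (Subtype.ext h)
    have h2 := Disk.radius_add_le_dist_invert (hgS (i t ht)).2 ht h1
    have h3 : Disk.invert x (g (i t ht)) = Disk.invert x t := hg (i t ht)
    rw [h3, dist_self] at h2
    have := (Disk.invert x t).radius_pos
    linarith
  have hnull := (hp.2 T hTS (i s hxs)).1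
  rw [sitePercolation, ← map_preimage_setBernoulli p hfinj] at hnull
  refine measure_mono_null ?_ (Measure.preimage_null_of_map_null
    (measurable_preimage_set f).aemeasurable hnull)
  rintro ω ⟨τ, rfl, hω, hadj, hx, hlim⟩
  refine ⟨fun n => i (τ n) (hx n), rfl, fun n => ?_, fun n => ?_, ?_⟩
  · rw [Set.mem_preimage, hfi _ (hx n)]
    exact hω n
  · exact (Disk.tangent_invert_iff (hx n) (hx (n + 1))).2 (hadj n)
  · refine tendsto_supDist _ fun M => ?_
    have hM : 0 < 2 * max M 1 := by positivity
    filter_upwards [hlim (2 * max M 1)⁻¹ (inv_pos.2 hM)] with n hn w hw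
    refine le_trans ?_ (Disk.le_norm_of_mem_invert (hx n) (inv_pos.2 hM) hn hw)
    have : (2 * (2 * max M 1)⁻¹)⁻¹ = max M 1 := by
      field_simp
    rw [this]
    exact le_max_left _ _

theorem hasInfiniteComponent_subset (hS : IsCirclePacking S) (hfin : IsLocallyFinite S)
    (hacc : (accumulationPoints S).Countable) :
    hasInfiniteComponent S ⊆ (⋃ s : S, connectedToInfinity s) ∪
      ⋃ x ∈ accumulationPoints S, ⋃ s : S, connectedToPoint x s := by
  rintro ω ⟨C, hC⟩
  obtain ⟨τ', hτ'inj, hτ'adj⟩ := exists_ray_of_infinite_component (G := openGraph S ω)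
    (fun v => Set.Finite.preimage Subtype.val_injective.injOn (hfin v)) hC
  set τ : ℕ → S := fun n => τ' n with hτ
  have hinj : Function.Injective τ := Subtype.val_injective.comp hτ'inj
  have hadj : ∀ n, (tangencyGraph S).Adj (τ n) (τ (n + 1)) := hτ'adj
  have hω : ∀ n, τ n ∈ ω := fun n => (τ' n).2
  by_cases h : ∃ M : ℝ, ∃ᶠ n in Filter.atTop,
      ((τ n : Disk).carrier ∩ Metric.closedBall 0 M).Nonempty
  · right
    obtain ⟨M, hM⟩ := h
    obtain ⟨x, -, hx⟩ := exists_frequently_of_isCompact (τ := fun n => (τ n : Disk))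
      (isCompact_closedBall 0 M) hM
    -- Different disks of the packing through `x` are tangent to each other, so local finiteness
    -- leaves only finitely many. Dropping an initial piece of the ray makes it avoid `x`.
    have hxfin : {n | x ∈ (τ n : Disk).carrier}.Finite := by
      by_contra hinf
      obtain ⟨m, hm⟩ := Set.Infinite.nonempty hinf
      refine hinf ((((hfin (τ m)).preimage hinj.injOn).insert m).subset fun n hn => ?_)
      by_cases hnm : n = m
      · exact Or.inl hnm
      · refine Or.inr (hS.tangent_of_mem (τ m).2 (τ n).2 (fun h => hnm ?_) hm hn)
        exact (hinj (Subtype.ext h)).symm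
    obtain ⟨N, hN⟩ := hxfin.bddAbove
    simp only [Set.mem_iUnion]
    refine ⟨x, mem_accumulationPoints_of_frequently hinj hx, τ (N + 1),
      fun n => τ (n + (N + 1)), by simp, fun n => hω _, fun n => ?_, fun n hn => ?_,
      fun δ hδ => ?_⟩
    · have := hadj (n + (N + 1))
      rwa [add_right_comm] at this
    · have := hN hn
      omega
    · exact (Filter.tendsto_add_atTop_nat (N + 1)).eventually
        (eventually_subset_ball hacc hinj hadj hx hδ)
  · left
    push Not at h
    refine Set.mem_iUnion.2 ⟨τ 0, τ, rfl, hω, hadj, tendsto_supDist _ fun M => ?_⟩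
    filter_upwards [h M] with n hn w hw
    by_contra hlt
    have : w ∈ (τ n : Disk).carrier ∩ Metric.closedBall 0 M :=
      ⟨hw, by simpa using (not_le.1 hlt).le⟩
    rw [hn] at this
    exact this

theorem IsUniversalParameter.hasInfiniteComponent_eq_zero {p : unitInterval}
    (hp : IsUniversalParameter p) (hS : IsCirclePacking S) (hfin : IsLocallyFinite S)
    (hacc : (accumulationPoints S).Countable) :
    sitePercolation S p (hasInfiniteComponent S) = 0 := by
  have : Countable S := hS.countable.to_subtype
  refine measure_mono_null (hasInfiniteComponent_subset hS hfin hacc) (measure_union_null ?_ ?_)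
  · exact measure_iUnion_null fun s => (hp.2 S hS s).1
  · exact (measure_biUnion_null_iff hacc).2 fun x _ => measure_iUnion_null fun s =>
      hp.connectedToPoint_eq_zero hS x s

end NoInfiniteComponent
end CirclePacking

theorem corollary2 :
    (∃ p : unitInterval, CirclePacking.IsUniversalParameter p) ∧
    ∀ p : unitInterval, CirclePacking.IsUniversalParameter p →
      ∀ S : Set CirclePacking.Disk, CirclePacking.IsCirclePacking S →
        CirclePacking.IsLocallyFinite S →
        (CirclePacking.accumulationPoints S).Countable →
        CirclePacking.sitePercolation S p (CirclePacking.hasInfiniteComponent S) = 0 :=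
  ⟨CirclePacking.exists_isUniversalParameter,
    fun _ hp _ hS hfin hacc => hp.hasInfiniteComponent_eq_zero hS hfin hacc⟩
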